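/- Let $n\ge 3$ and let $K\subset\mathbb R^3$ be a polygonal knot with vertices $v_1,\dots,v_n$ (indices modulo $n$) and edges $e_i=[v_i,v_{i+1}]$ of length $|e_i|$: the vertices are distinct, consecutive edges meet only at their common vertex, and all other pairs of distinct edges are disjoint. Let $\mathrm{angle}(v_i)\in[0,\pi)$ be the turning angle at $v_i$, i.e. the angle between $v_i-v_{i-1}$ and $v_{i+1}-v_i$, and put $$\mathrm{Rad}(v_i)=\frac{\min\{|e_{i-1}|,|e_i|\}}{2\tan(\mathrm{angle}(v_i)/2)},\qquad \mathrm{MinRad}(K)=\min_i \mathrm{Rad}(v_i),$$ where $\mathrm{Rad}(v_i)=\infty$ if $\mathrm{angle}(v_i)=0$. For $x\in K$ let $d_x(y)=\|x-y\|$ for $y\in K$; call $y$ a turning point of $d_x$ if, travelling along $K$, $d_x$ changes at $y$ from increasing to decreasing or from decreasing to increasing. Let $\mathrm{dcsd}(K)$ be the infimum of $\|x-y\|$ over all pairs of distinct points $x,y\in K$ such that $x$ is a turning point of $d_y$ and $y$ is a turning point of $d_x$. Put $R(K)=\min\{\mathrm{MinRad}(K),\ \mathrm{dcsd}(K)/2\}$,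 and for $r>0$ let $\mathrm{Tube}(K,r)$ be the union over all edges $e_i$ of the closed balls of radius $r$ centred at the points of $e_i$. If $0<r<R(K)$, then $\mathrm{Tube}(K,r)$ is an embedded solid torus with core $K$: there is a topological embedding $h\colon S^1\times D^2\to\mathbb R^3$ of the product of the circle and the closed disc with $h(S^1\times D^2)=\mathrm{Tube}(K,r)$ and $h(S^1\times\{0\})=K$. -/

import Mathlib

open scoped ENNReal

noncomputable section

namespace PolygonalKnot

/-- Euclidean three-space. -/
abbrev E3 : Type := EuclideanSpace ℝ (Fin 3)

/-- The edge `e i` joins `v i` to `v (i + 1)`; indices are taken modulo `n`. -/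
def edge {n : ℕ} (v : ZMod n → E3) (i : ZMod n) : Set E3 :=
  segment ℝ (v i) (v (i + 1))

/-- The point set of the closed polygon with vertices `v`. -/
def carrier {n : ℕ} (v : ZMod n → E3) : Set E3 :=
  ⋃ i, edge v i

/-- The cyclic sequence `v` of points is the vertex sequence of a polygonal knot: the vertices are
distinct, consecutive edges meet only at their common vertex, and all other pairs of distinct
edges are disjoint. -/
structure IsPolygonalKnot {n : ℕ} (v : ZMod n → E3) : Prop where
  three_le : 3 ≤ n
  injective : Function.Injective v
  consecutive : ∀ i, edge v i ∩ edge v (i + 1) = {v (i + 1)}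
  disjoint : ∀ i j, i ≠ j → j ≠ i + 1 → i ≠ j + 1 → Disjoint (edge v i) (edge v j)

/-- The length of the edge `e i`. -/
def edgeLength {n : ℕ} (v : ZMod n → E3) (i : ZMod n) : ℝ :=
  dist (v i) (v (i + 1))

/-- The turning angle at the vertex `v i`: the angle between the directions of the edge arriving
at `v i` and the edge leaving `v i` (it is `0` if the two edges are collinear). -/
def turningAngle {n : ℕ} (v : ZMod n → E3) (i : ZMod n) : ℝ :=
  InnerProductGeometry.angle (v i - v (i - 1)) (v (i + 1) - v i)

open Classical in
/-- `Rad (v i) = min (|e (i - 1)|) (|e i|) / (2 tan (angle (v i) / 2))`, which is `∞` if the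
turning angle is `0`. -/
def rad {n : ℕ} (v : ZMod n → E3) (i : ZMod n) : ℝ≥0∞ :=
  if turningAngle v i = 0 then ∞
  else ENNReal.ofReal
    (min (edgeLength v (i - 1)) (edgeLength v i) / (2 * Real.tan (turningAngle v i / 2)))

/-- `MinRad K`, the minimum of `Rad` over all vertices. -/
def minRad {n : ℕ} (v : ZMod n → E3) : ℝ≥0∞ :=
  ⨅ i, rad v i

/-- The `n`-periodic piecewise affine parametrization of the polygon, with `param v i = v i` at
integers `i`. -/
def param {n : ℕ} (v : ZMod n → E3) (t : ℝ) : E3 :=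
  AffineMap.lineMap (v (⌊t⌋ : ZMod n)) (v ((⌊t⌋ : ZMod n) + 1)) (Int.fract t)

/-- `y` is a turning point for `x`: travelling along the polygon, the distance to `x` changes at
`y` from increasing to decreasing or from decreasing to increasing. -/
def IsTurningPoint {n : ℕ} (v : ZMod n → E3) (x y : E3) : Prop :=
  ∃ t ε : ℝ, 0 < ε ∧ param v t = y ∧
    ((StrictMonoOn (fun s => dist x (param v s)) (Set.Icc (t - ε) t) ∧
        StrictAntiOn (fun s => dist x (param v s)) (Set.Icc t (t + ε))) ∨
      (StrictAntiOn (fun s => dist x (param v s)) (Set.Icc (t - ε) t) ∧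
        StrictMonoOn (fun s => dist x (param v s)) (Set.Icc t (t + ε))))

/-- The set `DC K` of doubly critical pairs. -/
def doublyCritical {n : ℕ} (v : ZMod n → E3) : Set (E3 × E3) :=
  {p | p.1 ∈ carrier v ∧ p.2 ∈ carrier v ∧ p.1 ≠ p.2 ∧
    IsTurningPoint v p.2 p.1 ∧ IsTurningPoint v p.1 p.2}

/-- The doubly-critical self-distance of the polygon. -/
def dcsd {n : ℕ} (v : ZMod n → E3) : ℝ≥0∞ :=
  ⨅ p ∈ doublyCritical v, edist p.1 p.2

/-- The polygonal thickness radius `R K = min (MinRad K) (dcsd K / 2)`. -/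
def thicknessRadius {n : ℕ} (v : ZMod n → E3) : ℝ≥0∞ :=
  min (minRad v) (dcsd v / 2)

/-- The union of the closed balls of radius `r` about the points of the edge `e i`. -/
def edgeTube {n : ℕ} (v : ZMod n → E3) (i : ZMod n) (r : ℝ) : Set E3 :=
  ⋃ x ∈ edge v i, Metric.closedBall x r

/-- `Tube (K, r)`, the union of the tubes about all edges. -/
def tube {n : ℕ} (v : ZMod n → E3) (r : ℝ) : Set E3 :=
  ⋃ i, edgeTube v i r

/-- `T` is an embedded solid torus in three-space with core curve `K`: it is the image of a
topological embedding of the product of the circle with the closed unit disc, under which the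
product of the circle with the centre of the disc goes onto `K`. -/
def IsEmbeddedSolidTorus (T K : Set E3) : Prop :=
  ∃ h : Circle × Metric.closedBall (0 : ℂ) 1 → E3,
    Topology.IsEmbedding h ∧ Set.range h = T ∧ h '' {p | (p.2 : ℂ) = 0} = K

end PolygonalKnot

end

/-! Fix `R` strictly between `r` and the thickness radius. As `R` is below MinRad, an arc of radius
`R` tangent to both edges fits into every corner and uses less than half of each edge. Attach to
each point `K t` a plane through it: orthogonal to the edge away from the corners and, in a corner,
the plane containing the axis of the inscribed circle. Its normal is `τ = u + q • n`, where `n` is a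
unit normal of the edge in the plane of the corner and `R * q` is the distance from `K t` to the
tangent point of the arc. Then `R * ‖τ‖` is the distance to the centre, and `arctan q` is the
turning of the plane, accumulated by `Θ`. At a vertex the plane bisects the corner, so the planes
vary continuously. The leaf at `t` (`InLeaf`) is the part of the plane with `excess` at most `r`.
The tube is a solid torus because the leaves are disjoint, cover it, and fit together.

Disjointness. Along the normal direction halfway through a turn `2η ≤ π`, the polygon advances at
least as far as an arc of radius `R` (`advance_mono`, `exists_advance`). A common point of two
leaves allows an advance governed only by `r < R`, so the turning between them exceeds `π` on both
sides (`pi_lt_turning`). Sliding both parameters to points of `K` within `r` of the common point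
preserves this, because a turn of exactly `π` forces a distance of at least `2R`
(`pi_lt_turning_of_path`). Among all pairs with turning at least `π` on both sides, a closest one is
then at distance at most `2r < 2R`, so it is interior to the constraint and is a local minimum in
each variable (`exists_local_min`). Such a pair is doubly critical and too short for dcsd.

Covering. For a point near `K` with a nearest point on some edge, its signed position relative to
the planes changes from nonnegative to nonpositive along that edge or a neighbouring one, so some
plane contains it (`exists_inLeaf_of_nearest`).

Assembly. Leaves are star-shaped about `K t` and are rescaled radially to discs
(`exists_embedding_of_leaves`). Oriented frames on adjacent edges match at the vertex up to a
rotation, which is spread along the edge. -/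

noncomputable section

open Real InnerProductGeometry

namespace PolygonalKnot

variable {E : Type*} [NormedAddCommGroup E] [InnerProductSpace ℝ E]

/-! ### Half-angle tangents and bending normals of two unit vectors. -/

/-- The tangent of half the angle between two vectors. -/
def htan (a b : E) : ℝ := tan (angle a b / 2)

/-- For unit vectors `a` and `b`, the unit normal to `a` pointing towards `b`
(zero if `a = b`). -/
def bend (a b : E) : E :=
  (htan a b)⁻¹ • (1 + inner ℝ a b)⁻¹ • (b - inner ℝ a b • a)

theorem htan_comm (a b : E) : htan a b = htan b a := by
  rw [htan, angle_comm, htan]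

theorem inner_self_one {a : E} (ha : ‖a‖ = 1) : inner ℝ a a = (1 : ℝ) := by
  rw [real_inner_self_eq_norm_sq, ha]; norm_num

theorem angle_lt_pi {a b : E} (ha : ‖a‖ = 1) (hb : ‖b‖ = 1) (h : -1 < inner ℝ a b) :
    angle a b < π := by
  rw [angle, ha, hb, mul_one, div_one]
  refine lt_of_le_of_ne (arccos_le_pi _) fun h' => ?_
  rw [arccos_eq_pi] at h'
  linarith

theorem htan_nonneg (a b : E) : 0 ≤ htan a b :=
  tan_nonneg_of_nonneg_of_le_pi_div_two (by linarith [angle_nonneg a b])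
    (by linarith [angle_le_pi a b])

/-- Half-angle formula for the tangent. Opposite vectors must be excluded: there `tan (π / 2)` has
the default value `0` and the identity fails. -/
theorem htan_sq {a b : E} (ha : ‖a‖ = 1) (hb : ‖b‖ = 1) (h : -1 < inner ℝ a b) :
    htan a b ^ 2 * (1 + inner ℝ a b) = 1 - inner ℝ a b := by
  have hc : inner ℝ a b = cos (angle a b) := by rw [cos_angle, ha, hb]; simp
  have h2 : cos (angle a b) = 2 * cos (angle a b / 2) ^ 2 - 1 := by
    rw [← cos_two_mul]; ring_nf
  have h3 := sin_sq_add_cos_sq (angle a b / 2)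
  have h4 : cos (angle a b / 2) ≠ 0 := by
    intro h5; rw [h5] at h2; rw [hc, h2] at h; norm_num at h
  rw [hc, h2, htan, tan_eq_sin_div_cos]
  field_simp
  nlinarith

theorem arctan_htan {a b : E} (ha : ‖a‖ = 1) (hb : ‖b‖ = 1) (h : -1 < inner ℝ a b) :
    arctan (htan a b) = angle a b / 2 :=
  arctan_tan (by linarith [angle_nonneg a b, pi_pos]) (by linarith [angle_lt_pi ha hb h])

theorem eq_of_htan_eq_zero {a b : E} (ha : ‖a‖ = 1) (hb : ‖b‖ = 1) (h : -1 < inner ℝ a b)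
    (h0 : htan a b = 0) : a = b := by
  have h1 := htan_sq ha hb h
  rw [h0] at h1
  exact (inner_eq_one_iff_of_norm_eq_one (𝕜 := ℝ) ha hb).1 (by linarith)

theorem htan_smul_bend {a b : E} (ha : ‖a‖ = 1) (hb : ‖b‖ = 1) (h : -1 < inner ℝ a b) :
    htan a b • bend a b = (1 + inner ℝ a b)⁻¹ • (b - inner ℝ a b • a) := by
  by_cases h0 : htan a b = 0
  · have := eq_of_htan_eq_zero ha hb h h0
    subst this
    simp [h0, ha]
  · rw [bend, smul_smul, mul_inv_cancel₀ h0, one_smul]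

/-- Tilting `a` by half the angle towards `b` gives the bisector, in a form symmetric in `a` and
`b`. This symmetry makes the normals agree at the vertices. -/
theorem add_htan_smul_bend {a b : E} (ha : ‖a‖ = 1) (hb : ‖b‖ = 1) (h : -1 < inner ℝ a b) :
    a + htan a b • bend a b = (1 + inner ℝ a b)⁻¹ • (a + b) := by
  have h1 : (1 + inner ℝ a b) ≠ (0 : ℝ) := by linarith
  rw [htan_smul_bend ha hb h]
  have : a = ((1 + inner ℝ a b)⁻¹ * (1 + inner ℝ a b)) • a := by
    rw [inv_mul_cancel₀ h1, one_smul]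
  nth_rewrite 1 [this]
  module

theorem inner_bend {a b : E} (ha : ‖a‖ = 1) : inner ℝ a (bend a b) = 0 := by
  simp only [bend, inner_smul_right, inner_sub_right, inner_self_one ha]
  ring

theorem norm_bend {a b : E} (ha : ‖a‖ = 1) (hb : ‖b‖ = 1) (h : -1 < inner ℝ a b)
    (h0 : htan a b ≠ 0) : ‖bend a b‖ = 1 := by
  have h1 := htan_sq ha hb h
  have h2 : (1 + inner ℝ a b) ≠ (0 : ℝ) := by linarith
  have : ‖bend a b‖ ^ 2 = 1 := by
    rw [← real_inner_self_eq_norm_sq]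
    simp only [bend, inner_smul_right, inner_smul_left, inner_sub_right, inner_sub_left,
      inner_self_one ha, inner_self_one hb, real_inner_comm a b]
    simp only [conj_trivial]
    have h3 : (1 - inner ℝ a b) ≠ (0 : ℝ) := by
      rw [← h1]; positivity
    have h4 : htan a b ^ 2 = (1 - inner ℝ a b) / (1 + inner ℝ a b) := by
      field_simp; linarith
    have : (htan a b)⁻¹ * ((htan a b)⁻¹) = (1 + inner ℝ a b) / (1 - inner ℝ a b) := by
      rw [← mul_inv, ← sq, h4, inv_div]
    calc _ = ((htan a b)⁻¹ * ((htan a b)⁻¹)) * ((1 + inner ℝ a b)⁻¹ * (1 + inner ℝ a b)⁻¹)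
          * (1 - inner ℝ a b ^ 2) := by ring
      _ = 1 := by rw [this]; field_simp; ring
  exact (pow_eq_one_iff_of_nonneg (norm_nonneg _) two_ne_zero).1 this

theorem norm_bend_le {a b : E} (ha : ‖a‖ = 1) (hb : ‖b‖ = 1) (h : -1 < inner ℝ a b) :
    ‖bend a b‖ ≤ 1 := by
  by_cases h0 : htan a b = 0
  · simp [bend, h0]
  · exact (norm_bend ha hb h h0).le

/-- Vectors `u + q n`, for orthonormal `u`, `n`, make the angle `arctan q` with `u`. -/
theorem angle_add_smul_le {u n : E} (hu : ‖u‖ = 1) (hn : ‖n‖ = 1) (hun : inner ℝ u n = 0)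
    (p q : ℝ) : angle (u + p • n) (u + q • n) ≤ |arctan q - arctan p| := by
  have hnorm : ∀ q : ℝ, ‖u + q • n‖ = √(1 + q ^ 2) := fun q => by
    rw [← sqrt_sq (norm_nonneg _), ← real_inner_self_eq_norm_sq]
    simp only [inner_add_left, inner_add_right, inner_smul_left, inner_smul_right,
      inner_self_one hu, inner_self_one hn, hun, real_inner_comm u n]
    simp only [conj_trivial]
    ring_nf
  have hin : inner ℝ (u + p • n) (u + q • n) = 1 + p * q := by
    simp only [inner_add_left, inner_add_right, inner_smul_left, inner_smul_right,
      inner_self_one hu, inner_self_one hn, hun, real_inner_comm u n]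
    simp only [conj_trivial]
    ring_nf
  have hp : (0 : ℝ) < √(1 + p ^ 2) := by positivity
  have hq : (0 : ℝ) < √(1 + q ^ 2) := by positivity
  have : cos (|arctan q - arctan p|) = (1 + p * q) / (√(1 + p ^ 2) * √(1 + q ^ 2)) := by
    rw [cos_abs, cos_sub, cos_arctan, cos_arctan, sin_arctan, sin_arctan]
    field_simp
  rw [angle, hin, hnorm, hnorm, ← this, arccos_cos (abs_nonneg _)]
  rw [abs_le]
  constructor <;> linarith [arctan_lt_pi_div_two p, arctan_lt_pi_div_two q,
    neg_pi_div_two_lt_arctan p, neg_pi_div_two_lt_arctan q]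

/-! ### Functions and relations on the line built from unit intervals. -/

/-- A function on the line given by its restrictions `H j` to the intervals `[j, j + 1]`,
translated to `[0, 1]`. -/
def piecewise {X : Type*} (H : ℤ → ℝ → X) (t : ℝ) : X := H ⌊t⌋ (Int.fract t)

theorem piecewise_eq {X : Type*} {H : ℤ → ℝ → X} (hH : ∀ j, H j 1 = H (j + 1) 0) (j : ℤ)
    {x : ℝ} (h0 : 0 ≤ x) (h1 : x ≤ 1) : piecewise H (j + x) = H j x := by
  rcases h1.lt_or_eq with h1 | rfl
  · have : ⌊(j : ℝ) + x⌋ = j := Int.floor_eq_iff.2 ⟨by linarith, by linarith⟩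
    rw [piecewise, Int.fract, this, add_sub_cancel_left]
  · have : ⌊(j : ℝ) + 1⌋ = j + 1 :=
      Int.floor_eq_iff.2 ⟨by push_cast; linarith, by push_cast; linarith⟩
    rw [piecewise, Int.fract, this, hH]
    simp

theorem exists_int_add (t : ℝ) : ∃ (j : ℤ) (x : ℝ), 0 ≤ x ∧ x < 1 ∧ t = j + x :=
  ⟨⌊t⌋, Int.fract t, Int.fract_nonneg t, Int.fract_lt_one t, (Int.floor_add_fract t).symm⟩

theorem locallyFinite_Icc_int : LocallyFinite fun j : ℤ => Set.Icc (j : ℝ) (j + 1) := by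
  intro t
  refine ⟨Metric.ball t 1, Metric.ball_mem_nhds t one_pos, ?_⟩
  refine (Set.finite_Icc (⌊t⌋ - 3) (⌊t⌋ + 3)).subset ?_
  rintro j ⟨s, ⟨h1, h2⟩, h3⟩
  rw [Metric.mem_ball, Real.dist_eq, abs_lt] at h3
  have h4 := Int.floor_le t
  have h5 := Int.lt_floor_add_one t
  constructor
  · have : ((⌊t⌋ - 3 : ℤ) : ℝ) < j := by push_cast; linarith
    exact_mod_cast this.le
  · have : (j : ℝ) < ((⌊t⌋ + 3 : ℤ) : ℝ) := by push_cast; linarith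
    exact_mod_cast this.le

theorem continuous_piecewise_uncurry {X Y : Type*} [TopologicalSpace X] [TopologicalSpace Y]
    {H : ℤ → ℝ → Y → X} (hH : ∀ j, H j 1 = H (j + 1) 0)
    (hc : ∀ j, Continuous fun p : ℝ × Y => H j p.1 p.2) :
    Continuous fun p : ℝ × Y => piecewise H p.1 p.2 := by
  have hl : LocallyFinite fun j : ℤ => (Prod.fst : ℝ × Y → ℝ) ⁻¹' Set.Icc (j : ℝ) (j + 1) :=
    locallyFinite_Icc_int.preimage_continuous continuous_fst
  refine hl.continuous ?_ (fun j => isClosed_Icc.preimage continuous_fst) fun j => ?_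
  · refine Set.eq_univ_of_forall fun p => Set.mem_iUnion.2 ⟨⌊p.1⌋, ?_, ?_⟩
    · exact Int.floor_le _
    · exact (Int.lt_floor_add_one _).le
  · have : Continuous fun p : ℝ × Y => H j (p.1 - j) p.2 :=
      (hc j).comp ((continuous_fst.sub continuous_const).prodMk continuous_snd)
    refine this.continuousOn.congr ?_
    rintro ⟨t, y⟩ ⟨h1, h2⟩
    simp only at h1 h2 ⊢
    have := piecewise_eq hH j (x := t - j) (by linarith) (by linarith)
    rw [add_sub_cancel] at this
    rw [this]

theorem continuous_piecewise {X : Type*} [TopologicalSpace X]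
    {H : ℤ → ℝ → X} (hH : ∀ j, H j 1 = H (j + 1) 0) (hc : ∀ j, Continuous (H j)) :
    Continuous (piecewise H) := by
  have := continuous_piecewise_uncurry (Y := Unit) (H := fun j x _ => H j x)
    (fun j => by simp [hH]) (fun j => (hc j).comp continuous_fst)
  exact this.comp (continuous_id.prodMk continuous_const : Continuous fun t : ℝ => (t, ()))

theorem piecewise_add_period {X : Type*} {H : ℤ → ℝ → X} {N : ℕ}
    (hH : ∀ j, H (j + N) = H j) (t : ℝ) : piecewise H (t + N) = piecewise H t := by
  have h1 : ⌊t + N⌋ = ⌊t⌋ + N := by simp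
  rw [piecewise, h1, hH, piecewise]
  simp

/-- A relation that is transitive along the line and holds within each interval `[j, j + 1]`
holds everywhere. -/
theorem rel_of_intervals {P : ℝ → ℝ → Prop}
    (trans : ∀ s m t, s ≤ m → m ≤ t → P s m → P m t → P s t)
    (loc : ∀ (j : ℤ) (x y : ℝ), 0 ≤ x → x ≤ y → y ≤ 1 → P (j + x) (j + y)) {s t : ℝ}
    (hst : s ≤ t) : P s t := by
  -- Here `k` counts the whole unit intervals between the two that contain the endpoints.
  have key : ∀ (k : ℕ) (j : ℤ) (x y : ℝ), 0 ≤ x → x ≤ 1 → 0 ≤ y → y ≤ 1 →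
      P (j + x) (j + 1 + k + y) := by
    intro k
    induction k with
    | zero =>
      intro j x y hx hx1 hy hy1
      refine trans _ (j + 1) _ (by linarith) (by push_cast; linarith) (loc j x 1 hx hx1 le_rfl) ?_
      have := loc (j + 1) 0 y le_rfl hy hy1
      push_cast at this ⊢
      simpa using this
    | succ k ih =>
      intro j x y hx hx1 hy hy1
      have h1 := ih j x 1 hx hx1 zero_le_one le_rfl
      have h2 := loc (j + 1 + (k + 1 : ℕ)) 0 y le_rfl hy hy1
      push_cast at h1 h2 ⊢
      rw [add_zero, ← add_assoc] at h2
      rw [← add_assoc]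
      have hk : (0 : ℝ) ≤ k := k.cast_nonneg
      exact trans _ _ _ (by linarith) (by linarith) h1 h2
  obtain ⟨i, x, hx, hx1, rfl⟩ := exists_int_add s
  obtain ⟨j, y, hy, hy1, rfl⟩ := exists_int_add t
  have hij : i ≤ j := by
    have : (i : ℝ) < j + 1 := by linarith
    have : i < j + 1 := by exact_mod_cast this
    omega
  rcases hij.eq_or_lt with rfl | hij
  · exact loc i x y hx (by linarith) hy1.le
  · obtain ⟨k, hk⟩ := Int.le.dest (show i + 1 ≤ j from hij)
    have := key k i x y hx hx1.le hy hy1.le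
    rw [← hk]
    push_cast
    exact this

end PolygonalKnot
end

/-! ### Thick polygons: normals of the cross-sections and accumulated turning. -/

noncomputable section

open Real InnerProductGeometry

namespace PolygonalKnot

variable {E : Type*} [NormedAddCommGroup E] [InnerProductSpace ℝ E]

/-- A closed polygon, unrolled to a periodic sequence of vertices `V j` with unit edge directions
`u j` and edge lengths `L j`, into whose corners arcs of radius `R` can be inscribed that use up
less than half of each adjacent edge. -/
structure ThickPolygon (E : Type*) [NormedAddCommGroup E] [InnerProductSpace ℝ E] where
  V : ℤ → E
  u : ℤ → E
  L : ℤ → ℝ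
  R : ℝ
  period : ℕ
  R_pos : 0 < R
  period_pos : 0 < period
  norm_u : ∀ j, ‖u j‖ = 1
  V_succ : ∀ j, V (j + 1) = V j + L j • u j
  neg_one_lt_inner : ∀ j, -1 < inner ℝ (u j) (u (j + 1))
  lt_length : ∀ j, 2 * R * htan (u j) (u (j + 1)) < L j
  lt_length_succ : ∀ j, 2 * R * htan (u j) (u (j + 1)) < L (j + 1)
  V_periodic : ∀ j, V (j + period) = V j
  u_periodic : ∀ j, u (j + period) = u j
  L_periodic : ∀ j, L (j + period) = L j

namespace ThickPolygon

variable (P : ThickPolygon E)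

/-- Tangent of half the turning angle at the end of the edge `j`. -/
def T (j : ℤ) : ℝ := htan (P.u j) (P.u (j + 1))

/-- The turning angle at the end of the edge `j`. -/
def α (j : ℤ) : ℝ := angle (P.u j) (P.u (j + 1))

/-- Accumulated turning angle of the edge directions. -/
def B (j : ℤ) : ℝ := ∑ i ∈ Finset.Ico 0 j, P.α i - ∑ i ∈ Finset.Ico j 0, P.α i

/-- Unit normal to the edge `j` towards the next edge. -/
def np (j : ℤ) : E := bend (P.u j) (P.u (j + 1))

/-- Unit normal to the edge `j` towards the previous edge. -/
def nm (j : ℤ) : E := bend (P.u j) (P.u (j - 1))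

/-- Relative length of the part of the edge `j`, up to the point of parameter `x`, that lies in
the corner at its end. -/
def qp (j : ℤ) (x : ℝ) : ℝ := max 0 (P.T j - P.L j / P.R * (1 - x))

/-- Relative length of the part of the edge `j`, from the point of parameter `x`, that lies in
the corner at its start. -/
def qm (j : ℤ) (x : ℝ) : ℝ := max 0 (P.T (j - 1) - P.L j / P.R * x)

/-- Parametrization of the edge `j`. -/
def edgeK (j : ℤ) (x : ℝ) : E := P.V j + (P.L j * x) • P.u j

/-- The tilt of the cross-section at the point of parameter `x` of the edge `j`. -/
def tilt (j : ℤ) (x : ℝ) : E := P.qp j x • P.np j + P.qm j x • P.nm j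

/-- Normal vector of the cross-section at the point of parameter `x` of the edge `j`. -/
def edgeτ (j : ℤ) (x : ℝ) : E := P.u j + P.tilt j x

/-- Accumulated turning up to the point of parameter `x` of the edge `j`. -/
def edgeΘ (j : ℤ) (x : ℝ) : ℝ := P.B j + (arctan (P.qp j x) - arctan (P.qm j x))

/-- The polygon. -/
def K : ℝ → E := piecewise P.edgeK

/-- Normal vectors of the cross-sections. -/
def τ : ℝ → E := piecewise P.edgeτ

/-- Accumulated turning. -/
def Θ : ℝ → ℝ := piecewise P.edgeΘ

theorem L_pos (j : ℤ) : 0 < P.L j :=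
  lt_of_le_of_lt (mul_nonneg (mul_nonneg zero_le_two P.R_pos.le) (htan_nonneg _ _)) (P.lt_length j)

theorem T_nonneg (j : ℤ) : 0 ≤ P.T j := htan_nonneg _ _

theorem two_T_lt (j : ℤ) : 2 * P.T j < P.L j / P.R := by
  rw [lt_div_iff₀ P.R_pos]
  have := P.lt_length j
  rw [← T] at this
  linarith

theorem two_T_pred_lt (j : ℤ) : 2 * P.T (j - 1) < P.L j / P.R := by
  rw [lt_div_iff₀ P.R_pos]
  have := P.lt_length_succ (j - 1)
  rw [← T, sub_add_cancel] at this
  linarith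

theorem lam_pos (j : ℤ) : 0 < P.L j / P.R := div_pos (P.L_pos j) P.R_pos

/-- The subtracted sum in `B` is what makes this recursion hold at negative indices too. -/
theorem B_succ (j : ℤ) : P.B (j + 1) = P.B j + P.α j := by
  rcases le_or_gt 0 j with h | h
  · rw [B, B, Finset.Ico_eq_empty (a := j + 1) (by omega), Finset.Ico_eq_empty (a := j) (by omega),
      ← Finset.insert_Ico_right_eq_Ico_add_one h, Finset.sum_insert (by simp)]
    simp [add_comm]
  · rw [B, B, Finset.Ico_eq_empty (b := j + 1) (by omega), Finset.Ico_eq_empty (b := j) (by omega),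
      ← Finset.insert_Ico_add_one_left_eq_Ico h, Finset.sum_insert (by simp)]
    simp

theorem neg_one_lt_inner_pred (j : ℤ) : -1 < inner ℝ (P.u j) (P.u (j - 1)) := by
  have := P.neg_one_lt_inner (j - 1)
  rwa [sub_add_cancel, real_inner_comm] at this

theorem T_pred (j : ℤ) : P.T (j - 1) = htan (P.u j) (P.u (j - 1)) := by
  rw [T, sub_add_cancel, htan_comm]

theorem inner_u_np (j : ℤ) : inner ℝ (P.u j) (P.np j) = 0 := inner_bend (P.norm_u j)

theorem inner_u_nm (j : ℤ) : inner ℝ (P.u j) (P.nm j) = 0 := inner_bend (P.norm_u j)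

theorem norm_np_le (j : ℤ) : ‖P.np j‖ ≤ 1 :=
  norm_bend_le (P.norm_u _) (P.norm_u _) (P.neg_one_lt_inner j)

theorem norm_nm_le (j : ℤ) : ‖P.nm j‖ ≤ 1 :=
  norm_bend_le (P.norm_u _) (P.norm_u _) (P.neg_one_lt_inner_pred j)

theorem norm_np {j : ℤ} (h : P.T j ≠ 0) : ‖P.np j‖ = 1 :=
  norm_bend (P.norm_u _) (P.norm_u _) (P.neg_one_lt_inner j) h

theorem norm_nm {j : ℤ} (h : P.T (j - 1) ≠ 0) : ‖P.nm j‖ = 1 :=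
  norm_bend (P.norm_u _) (P.norm_u _) (P.neg_one_lt_inner_pred j) (P.T_pred j ▸ h)

theorem qp_nonneg (j : ℤ) (x : ℝ) : 0 ≤ P.qp j x := le_max_left _ _

theorem qm_nonneg (j : ℤ) (x : ℝ) : 0 ≤ P.qm j x := le_max_left _ _

theorem qp_eq_of_pos {j : ℤ} {x : ℝ} (h : 0 < P.qp j x) :
    P.qp j x = P.T j - P.L j / P.R * (1 - x) := by
  rcases max_choice 0 (P.T j - P.L j / P.R * (1 - x)) with h1 | h1
  · rw [qp, h1] at h; exact absurd h (lt_irrefl _)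
  · exact h1

theorem qm_eq_of_pos {j : ℤ} {x : ℝ} (h : 0 < P.qm j x) :
    P.qm j x = P.T (j - 1) - P.L j / P.R * x := by
  rcases max_choice 0 (P.T (j - 1) - P.L j / P.R * x) with h1 | h1
  · rw [qm, h1] at h; exact absurd h (lt_irrefl _)
  · exact h1

/-- Each corner uses less than half of the edge, so the two corners of an edge do not overlap. -/
theorem half_lt_of_qp_pos {j : ℤ} {x : ℝ} (h : 0 < P.qp j x) : 1 / 2 < x := by
  have h1 := P.qp_eq_of_pos h
  have h2 := P.two_T_lt j
  by_contra! h3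
  nlinarith [P.lam_pos j]

theorem lt_half_of_qm_pos {j : ℤ} {x : ℝ} (h : 0 < P.qm j x) : x < 1 / 2 := by
  have h1 := P.qm_eq_of_pos h
  have h2 := P.two_T_pred_lt j
  by_contra! h3
  nlinarith [P.lam_pos j]

theorem qm_eq_zero_of_qp_pos {j : ℤ} {x : ℝ} (h : 0 < P.qp j x) : P.qm j x = 0 := by
  by_contra h1
  have h2 := P.lt_half_of_qm_pos (lt_of_le_of_ne (P.qm_nonneg j x) (Ne.symm h1))
  have h3 := P.half_lt_of_qp_pos h
  linarith

/-- At each point of an edge, one of the two corner coordinates vanishes. -/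
theorem qp_pos_or (j : ℤ) (x : ℝ) :
    (0 < P.qp j x ∧ P.qm j x = 0) ∨ (P.qp j x = 0 ∧ 0 ≤ P.qm j x) := by
  rcases (P.qp_nonneg j x).lt_or_eq with h | h
  · exact Or.inl ⟨h, P.qm_eq_zero_of_qp_pos h⟩
  · exact Or.inr ⟨h.symm, P.qm_nonneg j x⟩

theorem qp_mul_qm (j : ℤ) (x : ℝ) : P.qp j x * P.qm j x = 0 := by
  rcases P.qp_pos_or j x with ⟨_, h⟩ | ⟨h, _⟩ <;> simp [h]

theorem qp_le_T (j : ℤ) {x : ℝ} (h : x ≤ 1) : P.qp j x ≤ P.T j :=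
  max_le (P.T_nonneg j) (by nlinarith [P.lam_pos j])

theorem qm_le_T (j : ℤ) {x : ℝ} (h : 0 ≤ x) : P.qm j x ≤ P.T (j - 1) :=
  max_le (P.T_nonneg _) (by nlinarith [P.lam_pos j])

theorem qp_one (j : ℤ) : P.qp j 1 = P.T j := by simp [qp, P.T_nonneg]

theorem qm_zero (j : ℤ) : P.qm j 0 = P.T (j - 1) := by simp [qm, P.T_nonneg]

theorem qm_of_half_le {j : ℤ} {x : ℝ} (hx : 1 / 2 ≤ x) : P.qm j x = 0 := by
  by_contra h1
  have h2 := P.lt_half_of_qm_pos (lt_of_le_of_ne (P.qm_nonneg j x) (Ne.symm h1))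
  linarith

theorem qp_of_le_half {j : ℤ} {x : ℝ} (hx : x ≤ 1 / 2) : P.qp j x = 0 := by
  by_contra h1
  have h2 := P.half_lt_of_qp_pos (lt_of_le_of_ne (P.qp_nonneg j x) (Ne.symm h1))
  linarith

theorem qm_one (j : ℤ) : P.qm j 1 = 0 := P.qm_of_half_le (by norm_num)

theorem qp_zero (j : ℤ) : P.qp j 0 = 0 := P.qp_of_le_half (by norm_num)

theorem qp_mono (j : ℤ) : Monotone (P.qp j) := fun x y h =>
  max_le_max le_rfl (by nlinarith [P.lam_pos j])

theorem qm_anti (j : ℤ) : Antitone (P.qm j) := fun x y h =>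
  max_le_max le_rfl (by nlinarith [P.lam_pos j])

theorem tilt_one (j : ℤ) : P.tilt j 1 = P.T j • P.np j := by
  simp [tilt, qp_one, qm_one]

theorem tilt_zero (j : ℤ) : P.tilt (j + 1) 0 = P.T j • P.nm (j + 1) := by
  simp [tilt, qp_zero, qm_zero]

theorem edgeK_glue (j : ℤ) : P.edgeK j 1 = P.edgeK (j + 1) 0 := by
  simp [edgeK, P.V_succ]

/-- At a vertex the normals from both sides are the same multiple of the sum of the edge directions:
the cross-section bisects the corner. -/
theorem edgeτ_one (j : ℤ) :
    P.edgeτ j 1 = (1 + inner ℝ (P.u j) (P.u (j + 1)))⁻¹ • (P.u j + P.u (j + 1)) := by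
  rw [edgeτ, tilt_one]
  exact add_htan_smul_bend (P.norm_u _) (P.norm_u _) (P.neg_one_lt_inner j)

theorem edgeτ_zero (j : ℤ) :
    P.edgeτ (j + 1) 0 = (1 + inner ℝ (P.u j) (P.u (j + 1)))⁻¹ • (P.u j + P.u (j + 1)) := by
  have h1 := P.neg_one_lt_inner_pred (j + 1)
  have h2 := add_htan_smul_bend (P.norm_u _) (P.norm_u _) h1
  have h3 := P.T_pred (j + 1)
  rw [edgeτ, tilt_zero, nm]
  rw [← h3, add_sub_cancel_right] at h2
  rw [add_sub_cancel_right, h2, real_inner_comm, add_comm (P.u j)]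

theorem edgeτ_glue (j : ℤ) : P.edgeτ j 1 = P.edgeτ (j + 1) 0 := by
  rw [edgeτ_one, edgeτ_zero]

theorem arctan_T (j : ℤ) : arctan (P.T j) = P.α j / 2 :=
  arctan_htan (P.norm_u _) (P.norm_u _) (P.neg_one_lt_inner j)

/-- Half of the turning of a corner is accumulated before the vertex and half after it. -/
theorem edgeΘ_glue (j : ℤ) : P.edgeΘ j 1 = P.edgeΘ (j + 1) 0 := by
  simp only [edgeΘ, qp_one, qm_one, qp_zero, qm_zero, add_sub_cancel_right, arctan_T, B_succ,
    arctan_zero]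
  ring

theorem continuous_qp (j : ℤ) : Continuous (P.qp j) := by unfold qp; fun_prop

theorem continuous_qm (j : ℤ) : Continuous (P.qm j) := by unfold qm; fun_prop

theorem continuous_tilt (j : ℤ) : Continuous (P.tilt j) :=
  ((P.continuous_qp j).smul continuous_const).add ((P.continuous_qm j).smul continuous_const)

theorem K_eq (j : ℤ) {x : ℝ} (h0 : 0 ≤ x) (h1 : x ≤ 1) : P.K (j + x) = P.edgeK j x :=
  piecewise_eq P.edgeK_glue j h0 h1

theorem τ_eq (j : ℤ) {x : ℝ} (h0 : 0 ≤ x) (h1 : x ≤ 1) : P.τ (j + x) = P.edgeτ j x :=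
  piecewise_eq P.edgeτ_glue j h0 h1

theorem Θ_eq (j : ℤ) {x : ℝ} (h0 : 0 ≤ x) (h1 : x ≤ 1) : P.Θ (j + x) = P.edgeΘ j x :=
  piecewise_eq P.edgeΘ_glue j h0 h1

theorem continuous_K : Continuous P.K :=
  continuous_piecewise P.edgeK_glue fun j => by unfold edgeK; fun_prop

theorem continuous_Θ : Continuous P.Θ :=
  continuous_piecewise P.edgeΘ_glue fun j => continuous_const.add
    ((continuous_arctan.comp (P.continuous_qp j)).sub (continuous_arctan.comp (P.continuous_qm j)))

theorem inner_u_tilt (j : ℤ) (x : ℝ) : inner ℝ (P.u j) (P.tilt j x) = 0 := by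
  simp [tilt, inner_add_right, inner_smul_right, inner_u_np, inner_u_nm]

theorem norm_qp_smul (j : ℤ) {x : ℝ} (h : x ≤ 1) : ‖P.qp j x • P.np j‖ = P.qp j x := by
  rw [norm_smul, Real.norm_of_nonneg (P.qp_nonneg j x)]
  by_cases h0 : P.T j = 0
  · have : P.qp j x = 0 := le_antisymm (h0 ▸ P.qp_le_T j h) (P.qp_nonneg j x)
    simp [this]
  · rw [P.norm_np h0, mul_one]

theorem norm_qm_smul (j : ℤ) {x : ℝ} (h : 0 ≤ x) : ‖P.qm j x • P.nm j‖ = P.qm j x := by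
  rw [norm_smul, Real.norm_of_nonneg (P.qm_nonneg j x)]
  by_cases h0 : P.T (j - 1) = 0
  · have : P.qm j x = 0 := le_antisymm (h0 ▸ P.qm_le_T j h) (P.qm_nonneg j x)
    simp [this]
  · rw [P.norm_nm h0, mul_one]

theorem norm_tilt (j : ℤ) {x : ℝ} (h0 : 0 ≤ x) (h1 : x ≤ 1) :
    ‖P.tilt j x‖ = P.qp j x + P.qm j x := by
  rcases P.qp_pos_or j x with ⟨_, h⟩ | ⟨h, _⟩
  · rw [tilt, h, zero_smul, add_zero, add_zero, P.norm_qp_smul j h1]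
  · rw [tilt, h, zero_smul, zero_add, zero_add, P.norm_qm_smul j h0]

/-- Geometrically, in a corner `R * ‖τ‖` is the distance from the point of the edge to the centre of
the inscribed arc. -/
theorem norm_edgeτ_sq (j : ℤ) {x : ℝ} (h0 : 0 ≤ x) (h1 : x ≤ 1) :
    ‖P.edgeτ j x‖ ^ 2 = 1 + (P.qp j x - P.qm j x) ^ 2 := by
  rw [edgeτ, norm_add_sq_real, P.norm_u, P.inner_u_tilt, P.norm_tilt j h0 h1]
  linear_combination 4 * P.qp_mul_qm j x

theorem norm_edgeτ (j : ℤ) {x : ℝ} (h0 : 0 ≤ x) (h1 : x ≤ 1) :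
    ‖P.edgeτ j x‖ = √(1 + (P.qp j x - P.qm j x) ^ 2) := by
  rw [← P.norm_edgeτ_sq j h0 h1, sqrt_sq (norm_nonneg _)]

theorem arctan_q (j : ℤ) (x : ℝ) :
    arctan (P.qp j x) - arctan (P.qm j x) = arctan (P.qp j x - P.qm j x) := by
  rcases P.qp_pos_or j x with ⟨_, h⟩ | ⟨h, _⟩ <;> simp [h, arctan_neg]

theorem angle_u_edgeτ_le (j : ℤ) {x : ℝ} (h0 : 0 ≤ x) (h1 : x ≤ 1) :
    angle (P.u j) (P.edgeτ j x) ≤ |arctan (P.qp j x) - arctan (P.qm j x)| := by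
  have hu : P.u j ≠ 0 := by
    intro h; have := P.norm_u j; simp [h] at this
  rcases P.qp_pos_or j x with ⟨hp, h⟩ | ⟨h, hm⟩
  · have hT : P.T j ≠ 0 := by linarith [P.qp_le_T j h1]
    have := angle_add_smul_le (P.norm_u j) (P.norm_np hT) (P.inner_u_np j) 0 (P.qp j x)
    simpa [edgeτ, tilt, h] using this
  · rcases hm.lt_or_eq with hm | hm
    · have hT : P.T (j - 1) ≠ 0 := by linarith [P.qm_le_T j h0]
      have := angle_add_smul_le (P.norm_u j) (P.norm_nm hT) (P.inner_u_nm j) 0 (P.qm j x)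
      simpa [edgeτ, tilt, h] using this
    · simp [edgeτ, tilt, h, ← hm, angle_self hu]

theorem edgeΘ_mono (j : ℤ) : Monotone (P.edgeΘ j) := fun x y h => by
  have h1 := arctan_mono (P.qp_mono j h)
  have h2 := arctan_mono (P.qm_anti j h)
  simp only [edgeΘ]
  linarith

/-- Within one corner the normal rotates in a plane by the difference of the arctangents. Otherwise
the bound passes through the edge direction `u j` by the triangle inequality for angles. -/
theorem angle_edgeτ_le (j : ℤ) {x y : ℝ} (h0 : 0 ≤ x) (hxy : x ≤ y) (h1 : y ≤ 1) :
    angle (P.edgeτ j x) (P.edgeτ j y) ≤ P.edgeΘ j y - P.edgeΘ j x := by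
  have hmono := P.edgeΘ_mono j hxy
  have htri := angle_le_angle_add_angle (P.edgeτ j x) (P.u j) (P.edgeτ j y)
  rw [angle_comm _ (P.u j)] at htri
  have hx := P.angle_u_edgeτ_le j h0 (hxy.trans h1)
  have hy := P.angle_u_edgeτ_le j (h0.trans hxy) h1
  rcases P.qp_pos_or j x with ⟨hp, h⟩ | ⟨h, hm⟩
  · have hp' := hp.trans_le (P.qp_mono j hxy)
    have h' := P.qm_eq_zero_of_qp_pos hp'
    have hT : P.T j ≠ 0 := by linarith [P.qp_le_T j h1]
    have := angle_add_smul_le (P.norm_u j) (P.norm_np hT) (P.inner_u_np j) (P.qp j x) (P.qp j y)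
    rw [abs_of_nonneg (by linarith [arctan_mono (P.qp_mono j hxy)])] at this
    simpa [edgeτ, tilt, h, h', edgeΘ] using this
  · rw [abs_of_nonpos (by rw [h, arctan_zero]; linarith [arctan_nonneg.2 hm])] at hx
    rcases P.qp_pos_or j y with ⟨hp', h'⟩ | ⟨h', hm'⟩
    · rw [abs_of_nonneg (by rw [h', arctan_zero]; linarith [arctan_pos.2 hp'])] at hy
      simp only [edgeΘ]
      linarith
    · rcases hm.lt_or_eq with hm | hm
      · have hT : P.T (j - 1) ≠ 0 := by linarith [P.qm_le_T j h0]
        have := angle_add_smul_le (P.norm_u j) (P.norm_nm hT) (P.inner_u_nm j) (P.qm j x) (P.qm j y)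
        rw [abs_of_nonpos (by linarith [arctan_mono (P.qm_anti j hxy)])] at this
        simp only [edgeτ, tilt, h, h', edgeΘ, zero_smul, zero_add, arctan_zero]
        linarith
      · have hm'' : P.qm j y = 0 := le_antisymm (hm ▸ P.qm_anti j hxy) hm'
        rw [abs_of_nonneg (by simp [h', hm''])] at hy
        simp only [edgeΘ]
        linarith

/-- The normals turn at most as fast as the accumulated turning. -/
theorem angle_τ_le {s t : ℝ} (h : s ≤ t) : angle (P.τ s) (P.τ t) ≤ P.Θ t - P.Θ s := by
  refine rel_of_intervals (P := fun s t => angle (P.τ s) (P.τ t) ≤ P.Θ t - P.Θ s) ?_ ?_ h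
  · intro s m t _ _ h1 h2
    linarith [angle_le_angle_add_angle (P.τ s) (P.τ m) (P.τ t)]
  · intro j x y h0 hxy h1
    rw [P.τ_eq j h0 (hxy.trans h1), P.τ_eq j (h0.trans hxy) h1, P.Θ_eq j h0 (hxy.trans h1),
      P.Θ_eq j (h0.trans hxy) h1]
    exact P.angle_edgeτ_le j h0 hxy h1

theorem Θ_mono : Monotone P.Θ := fun s t h => by
  linarith [P.angle_τ_le h, angle_nonneg (P.τ s) (P.τ t)]

theorem angle_τ_le_abs (s t : ℝ) : angle (P.τ s) (P.τ t) ≤ |P.Θ t - P.Θ s| := by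
  rcases le_total s t with h | h
  · exact (P.angle_τ_le h).trans (le_abs_self _)
  · rw [angle_comm, abs_sub_comm]
    exact (P.angle_τ_le h).trans (le_abs_self _)

theorem τ_ne_zero (t : ℝ) : P.τ t ≠ 0 := by
  obtain ⟨j, x, h0, h1, rfl⟩ := exists_int_add t
  rw [P.τ_eq j h0 h1.le]
  intro h
  have := P.norm_edgeτ_sq j h0 h1.le
  rw [h, norm_zero] at this
  nlinarith

theorem one_le_norm_τ (t : ℝ) : 1 ≤ ‖P.τ t‖ := by
  obtain ⟨j, x, h0, h1, rfl⟩ := exists_int_add t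
  rw [P.τ_eq j h0 h1.le]
  have := P.norm_edgeτ_sq j h0 h1.le
  nlinarith [norm_nonneg (P.edgeτ j x), sq_nonneg (P.qp j x - P.qm j x)]

/-- No corner reaches the midpoint of an edge, so there the normal is `u j` and the accumulated
turning is `B j`. -/
theorem angle_τ_u_le (m : ℝ) (j : ℤ) : angle (P.τ m) (P.u j) ≤ |P.B j - P.Θ m| := by
  have h : P.τ (j + 1 / 2) = P.u j := by
    rw [P.τ_eq j (by norm_num) (by norm_num), edgeτ, tilt, P.qp_of_le_half le_rfl,
      P.qm_of_half_le le_rfl]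
    simp
  have h' : P.Θ (j + 1 / 2) = P.B j := by
    rw [P.Θ_eq j (by norm_num) (by norm_num), edgeΘ, P.qp_of_le_half le_rfl,
      P.qm_of_half_le le_rfl]
    simp
  rw [← h, ← h']
  exact P.angle_τ_le_abs _ _

end ThickPolygon
end PolygonalKnot
end

/-! ### Comparison of the polygon with arcs of radius `R`. -/

noncomputable section

open Real InnerProductGeometry

namespace PolygonalKnot

variable {E : Type*} [NormedAddCommGroup E] [InnerProductSpace ℝ E]

theorem cos_le_inner_of_angle_le {a b : E} {β : ℝ} (ha : ‖a‖ = 1) (hb : ‖b‖ = 1)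
    (h : angle a b ≤ |β|) (hβ : |β| ≤ π) : cos β ≤ inner ℝ a b := by
  have h1 : inner ℝ a b = cos (angle a b) := by rw [cos_angle, ha, hb]; simp
  rw [h1, ← cos_abs β]
  exact cos_le_cos_of_nonneg_of_le_pi (angle_nonneg _ _) hβ h

/-- Only the component of `a` orthogonal to `b` pairs with `w`, and its norm is the sine of the
angle. -/
theorem abs_inner_le_of_angle_le {a b w : E} {η : ℝ} (ha : ‖a‖ = 1) (hb : b ≠ 0)
    (hw : inner ℝ w b = 0) (h : angle a b ≤ η) (hη : η ≤ π / 2) :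
    |inner ℝ a w| ≤ ‖w‖ * sin η := by
  have hb' : ‖b‖ ≠ 0 := norm_ne_zero_iff.2 hb
  have hcos := cos_angle a b
  rw [ha, one_mul] at hcos
  set c := cos (angle a b) with hc
  have hin : inner ℝ a b = c * ‖b‖ := by rw [hcos]; field_simp
  have hbb : inner ℝ b b = ‖b‖ ^ 2 := real_inner_self_eq_norm_sq b
  set p := a - (c / ‖b‖) • b with hp
  have h1 : inner ℝ a w = inner ℝ p w := by
    rw [hp, inner_sub_left, inner_smul_left, real_inner_comm, real_inner_comm w b, hw]; simp
  have h2 : ‖p‖ ^ 2 = sin (angle a b) ^ 2 := by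
    rw [sin_sq, ← hc, hp, norm_sub_sq_real, ha, inner_smul_right, hin, norm_smul, Real.norm_eq_abs,
      mul_pow, sq_abs]
    field_simp
    ring
  have hs : 0 ≤ sin (angle a b) := sin_angle_nonneg a b
  have h3 : ‖p‖ = sin (angle a b) := (pow_left_inj₀ (norm_nonneg _) hs two_ne_zero).1 h2
  have h4 : sin (angle a b) ≤ sin η :=
    sin_le_sin_of_le_of_le_pi_div_two (by linarith [angle_nonneg a b, pi_pos]) hη h
  rw [h1]
  calc |inner ℝ p w| ≤ ‖p‖ * ‖w‖ := abs_real_inner_le_norm _ _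
    _ ≤ ‖w‖ * sin η := by rw [h3, mul_comm]; gcongr

namespace ThickPolygon

variable (P : ThickPolygon E)

/-- The addition formula with angle `arctan q`. On one edge it makes the comparison term affine in
`q = qp - qm`. -/
theorem norm_edgeτ_mul_sin (j : ℤ) {x : ℝ} (h0 : 0 ≤ x) (h1 : x ≤ 1) (θ : ℝ) :
    ‖P.edgeτ j x‖ * sin (P.edgeΘ j x - θ) =
      sin (P.B j - θ) + (P.qp j x - P.qm j x) * cos (P.B j - θ) := by
  have h : P.edgeΘ j x - θ = (P.B j - θ) + arctan (P.qp j x - P.qm j x) := by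
    rw [edgeΘ, arctan_q]; ring
  have h3 : (0 : ℝ) < √(1 + (P.qp j x - P.qm j x) ^ 2) := by positivity
  rw [h, sin_add, sin_arctan, cos_arctan, P.norm_edgeτ j h0 h1]
  field_simp

/-- As a function of `x`, `R * q` has slope `L j` in the corners and slope `0` between them. -/
theorem q_increment_le (j : ℤ) {x y : ℝ} (hxy : x ≤ y) :
    0 ≤ (P.qp j y - P.qm j y) - (P.qp j x - P.qm j x) ∧
    P.R * ((P.qp j y - P.qm j y) - (P.qp j x - P.qm j x)) ≤ P.L j * (y - x) := by
  have hp := P.qp_mono j hxy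
  have hm := P.qm_anti j hxy
  refine ⟨by linarith, ?_⟩
  have hR := P.R_pos
  have hlam := P.lam_pos j
  have hsum := P.two_T_lt j
  have hsum' := P.two_T_pred_lt j
  have hL : P.L j = P.R * (P.L j / P.R) := by field_simp
  rw [hL, mul_assoc]
  refine mul_le_mul_of_nonneg_left ?_ hR.le
  rcases P.qp_pos_or j y with ⟨a, b⟩ | ⟨a, b⟩
  · have h1 := P.qp_eq_of_pos a
    have h2 : P.T j - P.L j / P.R * (1 - x) ≤ P.qp j x := le_max_right _ _
    rcases P.qp_pos_or j x with ⟨c, d⟩ | ⟨c, d⟩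
    · rw [b, d]; nlinarith
    · rcases d.lt_or_eq with d | d
      · have h3 := P.qm_eq_of_pos d
        rw [b, c]; nlinarith
      · rw [b, ← d]; nlinarith
  · have h2 : P.T (j - 1) - P.L j / P.R * y ≤ P.qm j y := le_max_right _ _
    have h4 := P.qp_nonneg j x
    have h5 : P.qm j x - P.qm j y ≤ P.L j / P.R * (y - x) := by
      rcases (P.qm_nonneg j x).lt_or_eq with d | d
      · rw [P.qm_eq_of_pos d]; nlinarith
      · rw [← d]; nlinarith
    rw [a]; linarith

/-- Along the direction of the normal at `m`, the polygon advances at least as fast as an arc of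
radius `R`. -/
theorem advance_mono (m : ℝ) (T₀ : E) (hT : ‖T₀‖ = 1)
    (hang : ∀ j, angle T₀ (P.u j) ≤ |P.B j - P.Θ m|) {s t : ℝ} (hst : s ≤ t)
    (hs : -(π / 2) ≤ P.Θ s - P.Θ m) (ht : P.Θ t - P.Θ m ≤ π / 2) :
    inner ℝ T₀ (P.K s) - P.R * (‖P.τ s‖ * sin (P.Θ s - P.Θ m)) ≤
      inner ℝ T₀ (P.K t) - P.R * (‖P.τ t‖ * sin (P.Θ t - P.Θ m)) := by
  refine rel_of_intervals (P := fun s t => -(π / 2) ≤ P.Θ s - P.Θ m → P.Θ t - P.Θ m ≤ π / 2 →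
    inner ℝ T₀ (P.K s) - P.R * (‖P.τ s‖ * sin (P.Θ s - P.Θ m)) ≤
      inner ℝ T₀ (P.K t) - P.R * (‖P.τ t‖ * sin (P.Θ t - P.Θ m))) ?_ ?_ hst hs ht
  · intro s k t h1 h2 h3 h4 h5 h6
    have h7 := P.Θ_mono h1
    have h8 := P.Θ_mono h2
    exact (h3 h5 (by linarith)).trans (h4 (by linarith) h6)
  · intro j x y h0 hxy h1
    rw [P.τ_eq j h0 (hxy.trans h1), P.τ_eq j (h0.trans hxy) h1, P.Θ_eq j h0 (hxy.trans h1),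
      P.Θ_eq j (h0.trans hxy) h1, P.K_eq j h0 (hxy.trans h1), P.K_eq j (h0.trans hxy) h1]
    intro hs ht
    rw [P.norm_edgeτ_mul_sin j h0 (hxy.trans h1), P.norm_edgeτ_mul_sin j (h0.trans hxy) h1]
    have hmono := P.edgeΘ_mono j hxy
    set β := P.B j - P.Θ m with hβ
    have ex : P.edgeΘ j x - P.Θ m = β + (arctan (P.qp j x) - arctan (P.qm j x)) := by
      rw [edgeΘ]; ring
    have ey : P.edgeΘ j y - P.Θ m = β + (arctan (P.qp j y) - arctan (P.qm j y)) := by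
      rw [edgeΘ]; ring
    have hβπ : |β| ≤ π := by
      have := P.arctan_q j x
      have := P.arctan_q j y
      rw [abs_le]
      constructor <;>
      linarith [arctan_lt_pi_div_two (P.qp j x - P.qm j x),
        neg_pi_div_two_lt_arctan (P.qp j y - P.qm j y)]
    have hcos := cos_le_inner_of_angle_le hT (P.norm_u j) (hang j) hβπ
    obtain ⟨hq0, hq1⟩ := P.q_increment_le j hxy
    have hR := P.R_pos
    have hL := P.L_pos j
    -- After the addition formula the constant terms cancel, and this inequality between increments
    -- on one edge remains.
    have key : P.R * (((P.qp j y - P.qm j y) - (P.qp j x - P.qm j x)) * cos β) ≤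
        P.L j * (y - x) * inner ℝ T₀ (P.u j) := by
      have h3 : 0 ≤ P.L j * (y - x) := mul_nonneg hL.le (by linarith)
      rcases le_or_gt 0 (cos β) with hc | hc
      · nlinarith
      -- If `cos β < 0`, the edge direction is more than a right angle from the turning at `m`,
      -- while the cross-sections at `x` and `y` are not. So both points lie in the same corner,
      -- where `R * q` has slope exactly `L j`, and the sign of `cos β` is harmless.
      · suffices h : P.R * ((P.qp j y - P.qm j y) - (P.qp j x - P.qm j x)) = P.L j * (y - x) by
          rw [← mul_assoc, h]
          exact mul_le_mul_of_nonneg_left hcos h3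
        have hLR : P.R * (P.L j / P.R) = P.L j := by field_simp
        have hβ2 : π / 2 < |β| := by
          by_contra! h
          rw [← cos_abs] at hc
          linarith [cos_nonneg_of_neg_pi_div_two_le_of_le (by linarith [abs_nonneg β, pi_pos]) h]
        rcases lt_abs.1 hβ2 with h | h
        · have hy : 0 < P.qm j y := by
            by_contra! h4
            have : P.qm j y = 0 := le_antisymm h4 (P.qm_nonneg _ _)
            rw [this, arctan_zero] at ey
            linarith [arctan_nonneg.2 (P.qp_nonneg j y)]
          have hx := hy.trans_le (P.qm_anti j hxy)
          have hy' := P.qp_of_le_half (j := j) (P.lt_half_of_qm_pos hy).le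
          have hx' := P.qp_of_le_half (j := j) (P.lt_half_of_qm_pos hx).le
          rw [hx', hy', P.qm_eq_of_pos hx, P.qm_eq_of_pos hy]
          linear_combination (y - x) * hLR
        · have hx : 0 < P.qp j x := by
            by_contra! h4
            have : P.qp j x = 0 := le_antisymm h4 (P.qp_nonneg _ _)
            rw [this, arctan_zero] at ex
            linarith [arctan_nonneg.2 (P.qm_nonneg j x)]
          have hy := hx.trans_le (P.qp_mono j hxy)
          have hx' := P.qm_eq_zero_of_qp_pos hx
          have hy' := P.qm_eq_zero_of_qp_pos hy
          rw [hx', hy', P.qp_eq_of_pos hx, P.qp_eq_of_pos hy]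
          linear_combination (y - x) * hLR
    simp only [edgeK, inner_add_right, inner_smul_right]
    linarith

/-- Supplies the case of no turning, where the comparison with an arc only gives a lower bound of
zero. -/
theorem advance_strict (m : ℝ) (T₀ : E) (hT : ‖T₀‖ = 1)
    (hang : ∀ j, angle T₀ (P.u j) ≤ |P.B j - P.Θ m|) {s t : ℝ} (hst : s < t)
    (hs : P.Θ s = P.Θ m) (ht : P.Θ t = P.Θ m) : inner ℝ T₀ (P.K s) < inner ℝ T₀ (P.K t) := by
  refine rel_of_intervals (P := fun s t => P.Θ s = P.Θ m → P.Θ t = P.Θ m → s < t →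
    inner ℝ T₀ (P.K s) < inner ℝ T₀ (P.K t)) ?_ ?_ hst.le hs ht hst
  · intro s k t h1 h2 h3 h4 h5 h6 h
    have h7 := P.Θ_mono h1
    have h8 := P.Θ_mono h2
    have h9 : P.Θ k = P.Θ m := by linarith
    rcases h1.eq_or_lt with rfl | h1
    · exact h4 h5 h6 h
    · rcases h2.eq_or_lt with rfl | h2
      · exact h3 h5 h6 h
      · exact (h3 h5 h9 h1).trans (h4 h9 h6 h2)
  · intro j x y h0 hxy h1
    rw [P.Θ_eq j h0 (hxy.trans h1),
      P.Θ_eq j (h0.trans hxy) h1, P.K_eq j h0 (hxy.trans h1), P.K_eq j (h0.trans hxy) h1]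
    intro hs ht hlt
    have hlt : x < y := by linarith
    have e := P.arctan_q j x
    have l1 := arctan_lt_pi_div_two (P.qp j x - P.qm j x)
    have l2 := neg_pi_div_two_lt_arctan (P.qp j x - P.qm j x)
    rw [edgeΘ] at hs
    have hβ : P.B j - P.Θ m = - arctan (P.qp j x - P.qm j x) := by linarith
    have hcos := cos_le_inner_of_angle_le hT (P.norm_u j) (hang j)
      (by rw [hβ, abs_neg, abs_le]; constructor <;> linarith [pi_pos])
    rw [hβ, cos_neg] at hcos
    have hpos := (cos_arctan_pos (P.qp j x - P.qm j x)).trans_le hcos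
    simp only [edgeK, inner_add_right, inner_smul_right]
    have : 0 < P.L j * (y - x) * inner ℝ T₀ (P.u j) :=
      mul_pos (mul_pos (P.L_pos j) (by linarith)) hpos
    linarith

/-- If the polygon turns by `2 η ≤ π` between `a` and `b`, it advances in some direction as far as
an arc of radius `R` would. -/
theorem exists_advance {a b η : ℝ} (hab : a ≤ b) (hη : P.Θ b - P.Θ a = 2 * η)
    (hη' : η ≤ π / 2) :
    ∃ T₀ : E, ‖T₀‖ = 1 ∧ angle T₀ (P.τ a) ≤ η ∧ angle T₀ (P.τ b) ≤ η ∧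
      P.R * (‖P.τ a‖ + ‖P.τ b‖) * sin η ≤ inner ℝ T₀ (P.K b - P.K a) ∧
      (η = 0 → a < b → 0 < inner ℝ T₀ (P.K b - P.K a)) := by
  have hη0 : 0 ≤ η := by linarith [P.Θ_mono hab]
  -- The direction sought is the unit normal at a point `m` that halves the turning, so both end
  -- normals are within `η` of it.
  obtain ⟨m, ⟨ham, hmb⟩, hm⟩ := intermediate_value_Icc hab P.continuous_Θ.continuousOn
    (show P.Θ a + η ∈ Set.Icc (P.Θ a) (P.Θ b) from ⟨by linarith, by linarith⟩)
  have hτ : 0 < ‖P.τ m‖ := norm_pos_iff.2 (P.τ_ne_zero m)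
  set T₀ : E := ‖P.τ m‖⁻¹ • P.τ m with hT₀
  have hang : ∀ z, angle T₀ z = angle (P.τ m) z := fun z =>
    angle_smul_left_of_pos _ _ (inv_pos.2 hτ)
  have hT : ‖T₀‖ = 1 := by
    rw [hT₀, norm_smul, norm_inv, norm_norm, inv_mul_cancel₀ hτ.ne']
  have hangu : ∀ j, angle T₀ (P.u j) ≤ |P.B j - P.Θ m| := fun j => by
    rw [hang]; exact P.angle_τ_u_le m j
  refine ⟨T₀, hT, ?_, ?_, ?_, ?_⟩
  · rw [hang, angle_comm]; linarith [P.angle_τ_le ham]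
  · rw [hang]; linarith [P.angle_τ_le hmb]
  · have h1 := P.advance_mono m T₀ hT hangu ham (by linarith) (by linarith [pi_pos])
    have h2 := P.advance_mono m T₀ hT hangu hmb (by linarith [pi_pos]) (by linarith)
    rw [sub_self, sin_zero, mul_zero, mul_zero] at h1 h2
    have e1 : P.Θ a - P.Θ m = -η := by linarith
    have e2 : P.Θ b - P.Θ m = η := by linarith
    rw [e1, sin_neg] at h1
    rw [e2] at h2
    rw [inner_sub_right]
    linarith
  · intro h0 hlt
    rw [inner_sub_right, sub_pos]
    exact P.advance_strict m T₀ hT hangu hlt (by linarith) (by linarith)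

/-- For a half turn the sine in the advance estimate is `1`, so the advance bounds the distance from
below. -/
theorem norm_sub_ge_of_turning_eq_pi {a b : ℝ} (h : P.Θ b - P.Θ a = π) :
    P.R * (‖P.τ a‖ + ‖P.τ b‖) ≤ ‖P.K b - P.K a‖ := by
  have hab : a ≤ b := by
    by_contra! h1
    linarith [P.Θ_mono h1.le, pi_pos]
  obtain ⟨T₀, hT, -, -, h1, -⟩ := P.exists_advance hab (η := π / 2) (by linarith) le_rfl
  rw [sin_pi_div_two, mul_one] at h1
  refine h1.trans ((real_inner_le_norm _ _).trans ?_)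
  rw [hT, one_mul]

/-- The constant is the total turning of the closed polygon. -/
theorem Θ_add_period : ∃ c, ∀ t, P.Θ (t + P.period) = P.Θ t + c := by
  have hα : ∀ j, P.α (j + P.period) = P.α j := fun j => by
    rw [α, α, P.u_periodic, add_right_comm, P.u_periodic]
  have hB : ∀ j, P.B (j + P.period) = P.B j + P.B P.period := by
    intro j
    induction j with
    | zero => simp [B]
    | succ k ih => rw [add_right_comm, B_succ, ih, hα, B_succ]; ring
    | pred k ih =>
      have h1 := P.B_succ (-(k : ℤ) - 1)
      have h2 := P.B_succ (-(k : ℤ) - 1 + P.period)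
      rw [hα, add_right_comm, sub_add_cancel, ih] at h2
      rw [sub_add_cancel] at h1
      linarith
  have hT : ∀ j, P.T (j + P.period) = P.T j := fun j => by
    rw [T, T, P.u_periodic, add_right_comm, P.u_periodic]
  refine ⟨P.B P.period, fun t => ?_⟩
  have h1 : ⌊t + P.period⌋ = ⌊t⌋ + P.period := by simp
  have hT' := hT (⌊t⌋ - 1)
  rw [sub_add_eq_add_sub] at hT'
  simp only [Θ, piecewise, h1, edgeΘ, qp, qm, hB, hT, P.L_periodic, Int.fract_add_natCast, hT']
  ring

end ThickPolygon
end PolygonalKnot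
end

/-! ### Cross-sections and their disjointness. -/

noncomputable section

open Real InnerProductGeometry

namespace PolygonalKnot

variable {E : Type*} [NormedAddCommGroup E] [InnerProductSpace ℝ E]

/-- One-dimensional form of the passage from the base point `x` of a cross-section to the foot of
a point of that cross-section, at a corner of size `S` at the end of an edge of length `L`. -/
theorem exists_foot_real {L S k x : ℝ} (hL : 0 < L) (h0 : 0 ≤ x) (h1 : x ≤ 1)
    (hSL : S < L) (hk : |k| ≤ S - L * (1 - x)) :
    ∃ x' : ℝ, 0 ≤ x' ∧ x' ≤ 1 ∧ (L * (x - x') - k) ^ 2 ≤ max 0 (-k - L * (1 - x)) ^ 2 ∧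
      ∀ z ∈ Set.uIcc x x', |L * (x - z) - k| ≤ max 0 (S - L * (1 - z)) := by
  have hLk : L * (k / L) = k := by field_simp
  rw [abs_le] at hk
  have hfoot : (L * (x - (x - k / L)) - k) ^ 2 ≤ max 0 (-k - L * (1 - x)) ^ 2 := by
    have : L * (x - (x - k / L)) - k = 0 := by linear_combination hLk
    rw [this, zero_pow two_ne_zero]; positivity
  -- For `k ≤ 0` the foot lies towards the corner and is cut off at the end of the edge. For `k > 0`
  -- it lies away from the corner; the offset and the allowed range then shrink at the same rate
  -- along the way.
  rcases le_or_gt k 0 with hk0 | hk0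
  · have hkL : k / L ≤ 0 := div_nonpos_of_nonpos_of_nonneg hk0 hL.le
    have hxle : x ≤ min (x - k / L) 1 := le_min (by linarith) h1
    refine ⟨min (x - k / L) 1, h0.trans hxle, min_le_right _ _, ?_, fun z hz => ?_⟩
    · rcases le_total (x - k / L) 1 with h | h
      · rwa [min_eq_left h]
      · rw [min_eq_right h]
        have : L * 1 ≤ L * (x - k / L) := mul_le_mul_of_nonneg_left h hL.le
        have h5 : 0 ≤ -k - L * (1 - x) := by linarith
        rw [max_eq_right h5]
        exact le_of_eq (by ring)
    · rw [Set.uIcc_of_le hxle] at hz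
      have e1 : L * z ≤ L * (x - k / L) :=
        mul_le_mul_of_nonneg_left (hz.2.trans (min_le_left _ _)) hL.le
      have e2 : L * x ≤ L * z := mul_le_mul_of_nonneg_left hz.1 hL.le
      refine le_trans ?_ (le_max_right _ _)
      rw [abs_le]
      constructor <;> linarith
  · have hkL : 0 < k / L := div_pos hk0 hL
    have hx' : k / L ≤ x := by
      rw [div_le_iff₀ hL]; linarith
    refine ⟨x - k / L, by linarith, by linarith, hfoot, fun z hz => ?_⟩
    rw [Set.uIcc_of_ge (by linarith)] at hz
    have e1 : L * (x - k / L) ≤ L * z := mul_le_mul_of_nonneg_left hz.1 hL.le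
    have e2 : L * z ≤ L * x := mul_le_mul_of_nonneg_left hz.2 hL.le
    refine le_trans ?_ (le_max_right _ _)
    rw [abs_le]
    constructor <;> linarith

namespace ThickPolygon

variable (P : ThickPolygon E)

theorem T_periodic (j : ℤ) : P.T (j + P.period) = P.T j := by
  rw [T, T, P.u_periodic, add_right_comm, P.u_periodic]

theorem qp_periodic (j : ℤ) : P.qp (j + P.period) = P.qp j := by
  funext x; rw [qp, qp, P.T_periodic, P.L_periodic]

theorem qm_periodic (j : ℤ) : P.qm (j + P.period) = P.qm j := by
  funext x
  have := P.T_periodic (j - 1)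
  rw [sub_add_eq_add_sub] at this
  rw [qm, qm, this, P.L_periodic]

theorem np_periodic (j : ℤ) : P.np (j + P.period) = P.np j := by
  rw [np, np, P.u_periodic, add_right_comm, P.u_periodic]

theorem nm_periodic (j : ℤ) : P.nm (j + P.period) = P.nm j := by
  rw [nm, nm, P.u_periodic, add_sub_right_comm, P.u_periodic]

theorem tilt_periodic (j : ℤ) : P.tilt (j + P.period) = P.tilt j := by
  funext x
  rw [tilt, tilt, P.qp_periodic, P.qm_periodic, P.np_periodic, P.nm_periodic]

theorem K_periodic (t : ℝ) : P.K (t + P.period) = P.K t :=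
  piecewise_add_period (fun j => by
    funext x; rw [edgeK, edgeK, P.V_periodic, P.L_periodic, P.u_periodic]) t

theorem τ_periodic (t : ℝ) : P.τ (t + P.period) = P.τ t :=
  piecewise_add_period (fun j => by
    funext x; rw [edgeτ, edgeτ, P.u_periodic, P.tilt_periodic]) t

/-- The point of the cross-section at parameter `x` of the edge `j` whose component orthogonal
to the edge is `y`. -/
def point (j : ℤ) (x : ℝ) (y : E) : E :=
  P.edgeK j x + (y - inner ℝ y (P.tilt j x) • P.u j)

/-- The distance of `point j x y` from the polygon. -/
def excess (j : ℤ) (x : ℝ) (y : E) : ℝ :=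
  √(‖y‖ ^ 2 + max 0 (P.qm j x * inner ℝ y (P.nm j) - P.L j * x) ^ 2 +
    max 0 (-(P.qp j x * inner ℝ y (P.np j)) - P.L j * (1 - x)) ^ 2)

/-- The point `X` lies in the cross-section at `t` of the tube of radius `r`. -/
def InLeaf (r t : ℝ) (X : E) : Prop :=
  ∃ (j : ℤ) (x : ℝ) (y : E), 0 ≤ x ∧ x ≤ 1 ∧ t = j + x ∧ inner ℝ (P.u j) y = 0 ∧
    X = P.point j x y ∧ P.excess j x y ≤ r

theorem norm_le_excess (j : ℤ) (x : ℝ) (y : E) : ‖y‖ ≤ P.excess j x y := by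
  refine le_sqrt_of_sq_le ?_
  have := sq_nonneg (max 0 (P.qm j x * inner ℝ y (P.nm j) - P.L j * x))
  have := sq_nonneg (max 0 (-(P.qp j x * inner ℝ y (P.np j)) - P.L j * (1 - x)))
  linarith

/-- Pythagoras, with the components orthogonal to and along the edge. -/
theorem norm_point_sub_edgeK_sq (j : ℤ) (x x' : ℝ) {y : E} (hy : inner ℝ (P.u j) y = 0) :
    ‖P.point j x y - P.edgeK j x'‖ ^ 2 =
      ‖y‖ ^ 2 + (P.L j * (x - x') - inner ℝ y (P.tilt j x)) ^ 2 := by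
  have : P.point j x y - P.edgeK j x' =
      y + (P.L j * (x - x') - inner ℝ y (P.tilt j x)) • P.u j := by
    simp only [point, edgeK]; module
  rw [this, norm_add_sq_real, inner_smul_right, real_inner_comm (P.u j) y, hy, norm_smul, P.norm_u,
    Real.norm_eq_abs, mul_one, sq_abs]
  ring

theorem abs_inner_tilt_le (j : ℤ) {x : ℝ} (h0 : 0 ≤ x) (h1 : x ≤ 1) (y : E) :
    |inner ℝ y (P.tilt j x)| ≤ ‖y‖ * (P.qp j x + P.qm j x) := by
  rw [← P.norm_tilt j h0 h1]
  exact abs_real_inner_le_norm _ _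

variable {P}

theorem InLeaf.inner_eq_zero {r t : ℝ} {X : E} (h : P.InLeaf r t X) :
    inner ℝ (X - P.K t) (P.τ t) = 0 := by
  obtain ⟨j, x, y, h0, h1, rfl, hy, rfl, hr⟩ := h
  rw [P.K_eq j h0 h1, P.τ_eq j h0 h1, point, edgeτ, add_sub_cancel_left]
  rw [real_inner_comm] at hy
  simp only [inner_sub_left, inner_add_right, inner_smul_left, hy, inner_self_one (P.norm_u j),
    P.inner_u_tilt]
  simp

/-- The component along the edge is at most `‖y‖ * |q|`, so the squared distance is at most `r ^ 2 *
(1 + q ^ 2)`. -/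
theorem InLeaf.norm_sub_le {r t : ℝ} {X : E} (h : P.InLeaf r t X) :
    ‖X - P.K t‖ ≤ r * ‖P.τ t‖ := by
  obtain ⟨j, x, y, h0, h1, rfl, hy, rfl, hr⟩ := h
  have hyr := (P.norm_le_excess j x y).trans hr
  have hr0 : 0 ≤ r := (norm_nonneg y).trans hyr
  rw [P.K_eq j h0 h1, P.τ_eq j h0 h1]
  refine le_of_sq_le_sq ?_ (by positivity)
  rw [P.norm_point_sub_edgeK_sq j x x hy, sub_self, mul_zero, zero_sub, neg_sq, mul_pow,
    P.norm_edgeτ_sq j h0 h1]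
  have h2 := P.abs_inner_tilt_le j h0 h1 y
  have h3 : inner ℝ y (P.tilt j x) ^ 2 ≤ (‖y‖ * (P.qp j x + P.qm j x)) ^ 2 := by
    rw [← sq_abs]; gcongr
  have h4 : (P.qp j x + P.qm j x) ^ 2 = (P.qp j x - P.qm j x) ^ 2 := by
    linear_combination 4 * P.qp_mul_qm j x
  rw [mul_pow, h4] at h3
  have h5 : ‖y‖ ^ 2 ≤ r ^ 2 := by gcongr
  nlinarith [sq_nonneg (P.qp j x - P.qm j x)]

theorem R_mul_qp (j : ℤ) (z : ℝ) :
    P.R * P.qp j z = max 0 (P.R * P.T j - P.L j * (1 - z)) := by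
  have hR := P.R_pos
  rw [qp, ← mul_max_of_nonneg _ _ hR.le |>.symm, mul_zero]
  congr 1
  field_simp

theorem R_mul_qm (j : ℤ) (z : ℝ) :
    P.R * P.qm j z = max 0 (P.R * P.T (j - 1) - P.L j * z) := by
  have hR := P.R_pos
  rw [qm, ← mul_max_of_nonneg _ _ hR.le |>.symm, mul_zero]
  congr 1
  field_simp

/-- The allowed offset `R * q` at `z` is the distance to the tangent point of the arc. Together with
`‖y‖ < R` it keeps the point closer to the edge point at `z` than `R * ‖τ‖`. -/
theorem exists_foot_on_edge {r : ℝ} (hrR : r < P.R) (j : ℤ) {x : ℝ} (h0 : 0 ≤ x) (h1 : x ≤ 1) {y : E}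
    (hyr : ‖y‖ ≤ r) :
    ∃ x' : ℝ, 0 ≤ x' ∧ x' ≤ 1 ∧
      (P.L j * (x - x') - inner ℝ y (P.tilt j x)) ^ 2 ≤
        max 0 (P.qm j x * inner ℝ y (P.nm j) - P.L j * x) ^ 2 +
        max 0 (-(P.qp j x * inner ℝ y (P.np j)) - P.L j * (1 - x)) ^ 2 ∧
      ∀ z ∈ Set.uIcc x x', |P.L j * (x - z) - inner ℝ y (P.tilt j x)| ≤
        P.R * (P.qp j z + P.qm j z) := by
  have hR := P.R_pos
  have hL := P.L_pos j
  have hk := P.abs_inner_tilt_le j h0 h1 y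
  have hkr : |inner ℝ y (P.tilt j x)| ≤ P.R * (P.qp j x + P.qm j x) := hk.trans (by
    have := P.qp_nonneg j x
    have := P.qm_nonneg j x
    gcongr
    linarith)
  rcases P.qp_pos_or j x with ⟨hp, hm⟩ | ⟨hp, hm⟩
  · have hkeq : inner ℝ y (P.tilt j x) = P.qp j x * inner ℝ y (P.np j) := by
      rw [tilt, hm, zero_smul, add_zero, inner_smul_right]
    have hq : P.R * P.qp j x = P.R * P.T j - P.L j * (1 - x) := by
      rw [P.qp_eq_of_pos hp]; field_simp
    have hT := P.lt_length j
    rw [← T] at hT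
    rw [hm, add_zero, hq] at hkr
    obtain ⟨x', hx0, hx1, hf, hz⟩ := exists_foot_real hL h0 h1 (by linarith) hkr
    refine ⟨x', hx0, hx1, ?_, fun z hzz => ?_⟩
    · rw [← hkeq]
      exact hf.trans (le_add_of_nonneg_left (sq_nonneg _))
    · refine (hz z hzz).trans ?_
      rw [← R_mul_qp]
      exact mul_le_mul_of_nonneg_left (le_add_of_nonneg_right (P.qm_nonneg j z)) hR.le
  · have hkeq : inner ℝ y (P.tilt j x) = P.qm j x * inner ℝ y (P.nm j) := by
      rw [tilt, hp, zero_smul, zero_add, inner_smul_right]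
    rcases hm.eq_or_lt with h | hm
    · rw [← h, zero_mul] at hkeq
      refine ⟨x, h0, h1, ?_, fun z hz => ?_⟩
      · rw [hkeq, sub_self, mul_zero, sub_zero, zero_pow two_ne_zero]; positivity
      · rw [Set.uIcc_self, Set.mem_singleton_iff] at hz
        rw [hz, hkeq, sub_self, mul_zero, sub_zero, abs_zero]
        exact mul_nonneg hR.le (add_nonneg (P.qp_nonneg _ _) (P.qm_nonneg _ _))
    -- The corner at the start is the corner at the end of the reversed edge, with `x` replaced by
    -- `1 - x` and the offset negated.
    have hq : P.R * P.qm j x = P.R * P.T (j - 1) - P.L j * (1 - (1 - x)) := by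
      rw [P.qm_eq_of_pos hm]; field_simp; ring
    have hT := P.lt_length_succ (j - 1)
    rw [← T, sub_add_cancel] at hT
    rw [hp, zero_add, hq, ← abs_neg] at hkr
    obtain ⟨x', hx0, hx1, hf, hz⟩ := exists_foot_real hL (by linarith : 0 ≤ 1 - x) (by linarith)
      (by linarith) hkr
    refine ⟨1 - x', by linarith, by linarith, ?_, fun z hzz => ?_⟩
    · rw [← hkeq]
      refine le_trans ?_ (le_add_of_nonneg_right (sq_nonneg _))
      calc _ = (P.L j * (1 - x - x') - -inner ℝ y (P.tilt j x)) ^ 2 := by ring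
        _ ≤ _ := hf
        _ = _ := by rw [neg_neg, sub_sub_cancel]
    · have hz' := hz (1 - z) (by
        rw [Set.mem_uIcc] at hzz ⊢
        rcases hzz with ⟨_, _⟩ | ⟨_, _⟩
        · right; constructor <;> linarith
        · left; constructor <;> linarith)
      rw [sub_sub_cancel, ← R_mul_qm, ← abs_neg] at hz'
      calc _ = |-(P.L j * (1 - x - (1 - z)) - -inner ℝ y (P.tilt j x))| := by congr 1; ring
        _ ≤ _ := hz'
        _ ≤ _ := mul_le_mul_of_nonneg_left (le_add_of_nonneg_left (P.qp_nonneg j z)) hR.le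

/-- A point of a cross-section is within `r` of a point of the same edge that can be reached while
staying in the range of the inscribed arcs. -/
theorem InLeaf.exists_foot {r t : ℝ} (hrR : r < P.R) {X : E} (h : P.InLeaf r t X) :
    ∃ t', ‖X - P.K t'‖ ≤ r ∧ ∀ s ∈ Set.uIcc t t', ‖X - P.K s‖ < P.R * ‖P.τ s‖ := by
  obtain ⟨j, x, y, h0, h1, rfl, hy, rfl, hr⟩ := h
  have hyr := (P.norm_le_excess j x y).trans hr
  have hr0 : 0 ≤ r := (norm_nonneg y).trans hyr
  obtain ⟨x', h0', h1', hfoot, hpath⟩ := exists_foot_on_edge hrR j h0 h1 hyr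
  refine ⟨j + x', ?_, ?_⟩
  · rw [P.K_eq j h0' h1']
    refine le_trans ?_ hr
    rw [excess]
    refine le_sqrt_of_sq_le ?_
    rw [P.norm_point_sub_edgeK_sq j x x' hy]
    linarith
  · intro s hs
    obtain ⟨z, rfl⟩ : ∃ z, s = j + z := ⟨s - j, by ring⟩
    have hz : z ∈ Set.uIcc x x' := by
      rw [Set.mem_uIcc] at hs ⊢
      rcases hs with hs | hs
      · left; constructor <;> linarith [hs.1, hs.2]
      · right; constructor <;> linarith [hs.1, hs.2]
    have hz01 : z ∈ Set.Icc (0 : ℝ) 1 :=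
      Set.uIcc_subset_Icc ⟨h0, h1⟩ ⟨h0', h1'⟩ hz
    have h2 := hpath z hz
    rw [P.K_eq j hz01.1 hz01.2, P.τ_eq j hz01.1 hz01.2]
    have hR := P.R_pos
    refine lt_of_pow_lt_pow_left₀ 2 (by positivity) ?_
    rw [P.norm_point_sub_edgeK_sq j x z hy, mul_pow, P.norm_edgeτ_sq j hz01.1 hz01.2]
    have h3 : (P.L j * (x - z) - inner ℝ y (P.tilt j x)) ^ 2 ≤
        (P.R * (P.qp j z + P.qm j z)) ^ 2 := by
      rw [← sq_abs]; gcongr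
    have h4 : (P.qp j z + P.qm j z) ^ 2 = (P.qp j z - P.qm j z) ^ 2 := by
      linear_combination 4 * P.qp_mul_qm j z
    rw [mul_pow, h4] at h3
    have h5 : ‖y‖ ^ 2 < P.R ^ 2 := by
      have := hyr.trans_lt hrR
      gcongr
    linarith

/-- If the turning were `2η ≤ π`, the polygon would advance by at least `R * (‖τ a‖ + ‖τ b‖) * sin
η` in a direction within `η` of both normals. But `X` lies in both planes, which limits the advance
to the same expression with `r` in place of `R`. -/
theorem pi_lt_turning {r a b : ℝ} (hr : r < P.R) (hab : a < b) {X : E}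
    (ha : inner ℝ (X - P.K a) (P.τ a) = 0) (ha' : ‖X - P.K a‖ ≤ r * ‖P.τ a‖)
    (hb : inner ℝ (X - P.K b) (P.τ b) = 0) (hb' : ‖X - P.K b‖ ≤ r * ‖P.τ b‖) :
    π < P.Θ b - P.Θ a := by
  by_contra! h
  obtain ⟨T₀, hT, h1, h2, h3, h4⟩ := P.exists_advance hab.le
    (η := (P.Θ b - P.Θ a) / 2) (by ring) (by linarith)
  have hη0 : 0 ≤ (P.Θ b - P.Θ a) / 2 := by linarith [P.Θ_mono hab.le]
  have hη1 : (P.Θ b - P.Θ a) / 2 ≤ π / 2 := by linarith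
  set η := (P.Θ b - P.Θ a) / 2
  have e1 := abs_inner_le_of_angle_le hT (P.τ_ne_zero a) ha h1 hη1
  have e2 := abs_inner_le_of_angle_le hT (P.τ_ne_zero b) hb h2 hη1
  have hs : 0 ≤ sin η := sin_nonneg_of_nonneg_of_le_pi hη0 (by linarith [pi_pos])
  have e3 : inner ℝ T₀ (P.K b - P.K a) = inner ℝ T₀ (X - P.K a) - inner ℝ T₀ (X - P.K b) := by
    rw [← inner_sub_right]; congr 1; abel
  have e4 := (le_abs_self _).trans (e1.trans (mul_le_mul_of_nonneg_right ha' hs))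
  have e5 := (neg_le_abs _).trans (e2.trans (mul_le_mul_of_nonneg_right hb' hs))
  have e6 : inner ℝ T₀ (P.K b - P.K a) ≤ r * (‖P.τ a‖ + ‖P.τ b‖) * sin η := by
    rw [e3]; linarith
  -- Without turning both bounds are zero, and only the strict advance gives a contradiction.
  rcases hη0.eq_or_lt with h0 | h0
  · have := h4 h0.symm hab
    rw [← h0, sin_zero] at e6
    linarith
  · have hs' : 0 < sin η := sin_pos_of_pos_of_lt_pi h0 (by linarith [pi_pos])
    have hτ : 0 < ‖P.τ a‖ + ‖P.τ b‖ := by linarith [P.one_le_norm_τ a, P.one_le_norm_τ b]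
    have := mul_pos (mul_pos (sub_pos.2 hr) hτ) hs'
    linarith

/-- To drop to `π` or below, the turning would have to equal `π` somewhere. There the two points are
at least `R * (‖τ‖ + ‖τ‖)` apart, against the triangle inequality through `X`. -/
theorem pi_lt_turning_of_path {f g : ℝ → ℝ} (hf : Continuous f) (hg : Continuous g) {X : E}
    (hfX : ∀ θ ∈ Set.Icc (0 : ℝ) 1, ‖X - P.K (f θ)‖ < P.R * ‖P.τ (f θ)‖)
    (hgX : ∀ θ ∈ Set.Icc (0 : ℝ) 1, ‖X - P.K (g θ)‖ < P.R * ‖P.τ (g θ)‖)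
    (h : π < P.Θ (g 0) - P.Θ (f 0)) : π < P.Θ (g 1) - P.Θ (f 1) := by
  by_contra! h1
  obtain ⟨θ, hθ, h2⟩ := intermediate_value_Icc' (f := fun θ => P.Θ (g θ) - P.Θ (f θ)) zero_le_one
    (((P.continuous_Θ.comp hg).sub (P.continuous_Θ.comp hf)).continuousOn)
    (show π ∈ Set.Icc _ _ from ⟨h1, h.le⟩)
  have h3 := P.norm_sub_ge_of_turning_eq_pi h2
  have h4 : ‖P.K (g θ) - P.K (f θ)‖ ≤ ‖X - P.K (f θ)‖ + ‖X - P.K (g θ)‖ := by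
    have : P.K (g θ) - P.K (f θ) = (X - P.K (f θ)) - (X - P.K (g θ)) := by abel
    rw [this]; exact norm_sub_le _ _
  linarith [hfX θ hθ, hgX θ hθ]

/-- The smallest distance between points separated by turning of at least `π` on both sides is a
local minimum of the distance in each variable, if it is small. -/
theorem exists_local_min {r a b : ℝ} (hr : r < P.R) (h1 : π ≤ P.Θ b - P.Θ a)
    (h2 : π ≤ P.Θ (a + P.period) - P.Θ b) (hd : ‖P.K b - P.K a‖ ≤ 2 * r) :
    ∃ s t : ℝ, s < t ∧ t < s + P.period ∧ ‖P.K t - P.K s‖ ≤ 2 * r ∧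
      IsLocalMin (fun x => dist (P.K t) (P.K x)) s ∧
      IsLocalMin (fun x => dist (P.K s) (P.K x)) t := by
  obtain ⟨c, hc⟩ := P.Θ_add_period
  have hN : (0 : ℝ) < P.period := by exact_mod_cast P.period_pos
  have hπ := pi_pos
  have lt_of_Θ : ∀ {x y : ℝ}, P.Θ x < P.Θ y → x < y := fun {x y} h => by
    by_contra! h'
    linarith [P.Θ_mono h']
  -- The first parameter is confined to one period for compactness; the turning conditions then
  -- bound the second.
  set S : Set (ℝ × ℝ) := {p | p.1 ∈ Set.Icc a (a + P.period) ∧ π ≤ P.Θ p.2 - P.Θ p.1 ∧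
    π ≤ P.Θ (p.1 + P.period) - P.Θ p.2} with hS
  have hΘ := P.continuous_Θ
  have hSclosed : IsClosed S := by
    refine (isClosed_Icc.preimage continuous_fst).inter (IsClosed.inter ?_ ?_)
    · exact isClosed_le continuous_const
        (by fun_prop : Continuous fun p : ℝ × ℝ => P.Θ p.2 - P.Θ p.1)
    · exact isClosed_le continuous_const
        (by fun_prop : Continuous fun p : ℝ × ℝ => P.Θ (p.1 + P.period) - P.Θ p.2)
  have hScpt : IsCompact S := by
    refine (isCompact_Icc.prod isCompact_Icc).of_isClosed_subset hSclosed
      (?_ : S ⊆ Set.Icc a (a + P.period) ×ˢ Set.Icc a (a + P.period + P.period))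
    rintro ⟨s, t⟩ ⟨h3, h4, h5⟩
    simp only at h3 h4 h5
    have := lt_of_Θ (show P.Θ s < P.Θ t by linarith)
    have := lt_of_Θ (show P.Θ t < P.Θ (s + P.period) by linarith)
    exact ⟨h3, by simp only; linarith [h3.1], by simp only; linarith [h3.2]⟩
  have hK := P.continuous_K
  obtain ⟨⟨s, t⟩, ⟨hs, hst, hts⟩, hmin⟩ := hScpt.exists_isMinOn
    (f := fun p : ℝ × ℝ => dist (P.K p.1) (P.K p.2))
    ⟨(a, b), ⟨le_rfl, by simp only; linarith⟩, h1, h2⟩ (by fun_prop)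
  simp only at hs hst hts
  -- A shift by a multiple of the period removes the restriction to one period, so parameters near
  -- `s` may leave the interval.
  have hmin' : ∀ x y, π ≤ P.Θ y - P.Θ x → π ≤ P.Θ (x + P.period) - P.Θ y →
      dist (P.K s) (P.K t) ≤ dist (P.K x) (P.K y) := by
    intro x y hx hy
    obtain ⟨k, hk, -⟩ := existsUnique_add_zsmul_mem_Ico hN x a
    rw [zsmul_eq_mul] at hk
    have hKk : ∀ x, P.K (x + k * P.period) = P.K x :=
      (show Function.Periodic P.K P.period from P.K_periodic).int_mul k
    have hΘk : ∀ x, P.Θ (x + k * P.period) = P.Θ x + k * c := fun x => by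
      have hper : Function.Periodic (fun x => P.Θ x - x * (c / P.period)) P.period := fun x => by
        simp only [hc]; field_simp; ring
      have := hper.int_mul k x
      have e : (k * P.period : ℝ) * (c / P.period) = k * c := by field_simp
      linarith
    have := hmin (show (x + k * P.period, y + k * P.period) ∈ S from
      ⟨⟨hk.1, hk.2.le⟩, by simp only [hΘk]; linarith, by
        simp only [hc] at hy ⊢; simp only [hΘk]; linarith⟩)
    simpa only [Set.mem_ofPred_eq, hKk] using this
  have hle : ‖P.K t - P.K s‖ ≤ 2 * r := by
    rw [← dist_eq_norm, dist_comm]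
    refine (hmin' a b h1 h2).trans ?_
    rwa [dist_comm, dist_eq_norm]
  have hlarge : ∀ x y, 2 * P.R ≤ P.R * (‖P.τ x‖ + ‖P.τ y‖) := fun x y => by
    nlinarith [P.one_le_norm_τ x, P.one_le_norm_τ y, P.R_pos]
  -- The minimum is not on the boundary of the constraint: a turn of exactly `π` forces distance at
  -- least `2 * R > 2 * r`.
  have hst' : π < P.Θ t - P.Θ s := by
    refine lt_of_le_of_ne hst fun h => ?_
    linarith [P.norm_sub_ge_of_turning_eq_pi h.symm, hlarge s t]
  have hts' : π < P.Θ (s + P.period) - P.Θ t := by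
    refine lt_of_le_of_ne hts fun h => ?_
    have := P.norm_sub_ge_of_turning_eq_pi h.symm
    rw [P.K_periodic, norm_sub_rev] at this
    linarith [hlarge t (s + P.period)]
  refine ⟨s, t, lt_of_Θ (by linarith), lt_of_Θ (by linarith), hle, ?_, ?_⟩
  · have e1 : ∀ᶠ x in nhds s, π < P.Θ t - P.Θ x :=
      (show Continuous fun x => P.Θ t - P.Θ x by fun_prop).continuousAt.eventually_const_lt hst'
    have e2 : ∀ᶠ x in nhds s, π < P.Θ (x + P.period) - P.Θ t :=
      (show Continuous fun x => P.Θ (x + P.period) - P.Θ t by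
        fun_prop).continuousAt.eventually_const_lt hts'
    filter_upwards [e1, e2] with x h3 h4
    rw [dist_comm, dist_comm _ (P.K x)]
    exact hmin' x t h3.le h4.le
  · have e1 : ∀ᶠ x in nhds t, π < P.Θ x - P.Θ s :=
      (show Continuous fun x => P.Θ x - P.Θ s by fun_prop).continuousAt.eventually_const_lt hst'
    have e2 : ∀ᶠ x in nhds t, π < P.Θ (s + P.period) - P.Θ x :=
      (show Continuous fun x => P.Θ (s + P.period) - P.Θ x by
        fun_prop).continuousAt.eventually_const_lt hts'
    filter_upwards [e1, e2] with x h3 h4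
    exact hmin' s x h3.le h4.le

/-- Different cross-sections are disjoint if there are no short doubly critical pairs. -/
theorem InLeaf.false_of_lt {r : ℝ} (hr : r < P.R)
    (hdc : ∀ s t : ℝ, s < t → t < s + P.period → IsLocalMin (fun x => dist (P.K t) (P.K x)) s →
      IsLocalMin (fun x => dist (P.K s) (P.K x)) t → 2 * r < ‖P.K t - P.K s‖)
    {a b : ℝ} {X : E} (ha : P.InLeaf r a X) (hb : P.InLeaf r b X) (hab : a < b)
    (hba : b < a + P.period) : False := by
  have h1 := pi_lt_turning hr hab ha.inner_eq_zero ha.norm_sub_le hb.inner_eq_zero hb.norm_sub_le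
  have h2 := pi_lt_turning hr hba hb.inner_eq_zero hb.norm_sub_le (X := X)
    (by rw [P.K_periodic, P.τ_periodic]; exact ha.inner_eq_zero)
    (by rw [P.K_periodic, P.τ_periodic]; exact ha.norm_sub_le)
  obtain ⟨a', ha', hpa⟩ := ha.exists_foot hr
  obtain ⟨b', hb', hpb⟩ := hb.exists_foot hr
  have hmem : ∀ {p q θ : ℝ}, θ ∈ Set.Icc (0 : ℝ) 1 → p + θ * (q - p) ∈ Set.uIcc p q := by
    intro p q θ hθ
    rw [← segment_eq_uIcc]
    exact ⟨1 - θ, θ, by linarith [hθ.2], hθ.1, by ring, by simp only [smul_eq_mul]; ring⟩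
  -- Both parameters slide linearly from the cross-sections through `X` to points of the polygon
  -- within `r` of `X`.
  set f : ℝ → ℝ := fun θ => a + θ * (a' - a) with hf
  set g : ℝ → ℝ := fun θ => b + θ * (b' - b) with hg
  have hfc : Continuous f := by fun_prop
  have hgc : Continuous g := by fun_prop
  have h3 := pi_lt_turning_of_path hfc hgc (X := X) (fun θ hθ => hpa _ (hmem hθ))
    (fun θ hθ => hpb _ (hmem hθ)) (by simpa [hf, hg] using h1)
  have h4 := pi_lt_turning_of_path (g := fun θ => f θ + P.period) hgc (by fun_prop) (X := X)
    (fun θ hθ => hpb _ (hmem hθ))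
    (fun θ hθ => by simp only [P.K_periodic, P.τ_periodic]; exact hpa _ (hmem hθ))
    (by simpa [hf, hg] using h2)
  simp only [hf, hg, one_mul, add_sub_cancel] at h3 h4
  have hd : ‖P.K b' - P.K a'‖ ≤ 2 * r := by
    have : P.K b' - P.K a' = (X - P.K a') - (X - P.K b') := by abel
    rw [this]; linarith [_root_.norm_sub_le (X - P.K a') (X - P.K b')]
  obtain ⟨s, t, hst, hts, hle, m1, m2⟩ := exists_local_min hr h3.le h4.le hd
  exact absurd (hdc s t hst hts m1 m2) (not_lt.2 hle)

end ThickPolygon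
end PolygonalKnot
end

/-! ### The cross-sections cover the tube. -/

noncomputable section

open Real InnerProductGeometry

namespace PolygonalKnot

variable {E : Type*} [NormedAddCommGroup E] [InnerProductSpace ℝ E]

namespace ThickPolygon

variable {P : ThickPolygon E}

/-- The intermediate value theorem finds a plane through `X` between the ends of the edge. Its
`excess` is at most the distance from `X` to any point of that edge. -/
theorem exists_inLeaf_of_sign {r : ℝ} (hr : 0 ≤ r) {X : E} (j : ℤ) {x₀ : ℝ} (h0 : 0 ≤ x₀)
    (h1 : x₀ ≤ 1)
    (hX : ‖X - P.edgeK j x₀‖ ≤ r) (hs : 0 ≤ inner ℝ (X - P.edgeK j 0) (P.edgeτ j 0))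
    (he : inner ℝ (X - P.edgeK j 1) (P.edgeτ j 1) ≤ 0) : ∃ t, P.InLeaf r t X := by
  have hcont : Continuous fun x => inner ℝ (X - P.edgeK j x) (P.edgeτ j x) := by
    refine Continuous.inner ?_ (continuous_const.add (P.continuous_tilt j))
    unfold edgeK
    fun_prop
  obtain ⟨x, ⟨hx0, hx1⟩, hx⟩ := intermediate_value_Icc' zero_le_one hcont.continuousOn
    (show (0 : ℝ) ∈ Set.Icc _ _ from ⟨he, hs⟩)
  have huu := inner_self_one (P.norm_u j)
  set a : ℝ := inner ℝ (P.u j) (X - P.V j) with ha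
  set y : E := X - P.V j - a • P.u j with hy
  have hyu : inner ℝ (P.u j) y = 0 := by
    rw [hy, inner_sub_right, ← ha, inner_smul_right, huu]; ring
  have hXeq : X = P.V j + a • P.u j + y := by rw [hy]; abel
  have hk : inner ℝ y (P.tilt j x) = P.L j * x - a := by
    have e : X - P.edgeK j x = (a - P.L j * x) • P.u j + y := by
      nth_rewrite 1 [hXeq]; simp only [edgeK]; module
    simp only [e, edgeτ, inner_add_left, inner_add_right, inner_smul_left, huu, P.inner_u_tilt,
      real_inner_comm (P.u j) y, hyu] at hx
    simp only [conj_trivial] at hx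
    linarith
  have hpt : X = P.point j x y := by
    rw [point, hk, edgeK]; nth_rewrite 1 [hXeq]; module
  refine ⟨j + x, j, x, y, hx0, hx1, rfl, hyu, hpt, ?_⟩
  have hd := P.norm_point_sub_edgeK_sq j x x₀ hyu
  rw [← hpt] at hd
  rw [excess]
  refine sqrt_le_iff.2 ⟨hr, ?_⟩
  have hle : ‖X - P.edgeK j x₀‖ ^ 2 ≤ r ^ 2 := by gcongr
  refine le_trans ?_ hle
  rw [hd, add_assoc]
  gcongr
  have hL := P.L_pos j
  -- As `x₀` lies in `[0, 1]`, the offset of `X` from it along the edge is at least the overshoot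
  -- beyond an end that `excess` records.
  rcases P.qp_pos_or j x with ⟨hp, hm⟩ | ⟨hp, hm⟩
  · have hkeq : inner ℝ y (P.tilt j x) = P.qp j x * inner ℝ y (P.np j) := by
      rw [tilt, hm, zero_smul, add_zero, inner_smul_right]
    rw [← hkeq, hm, zero_mul, max_eq_left (by nlinarith : 0 - P.L j * x ≤ 0),
      zero_pow two_ne_zero, zero_add]
    rcases le_total 0 (-inner ℝ y (P.tilt j x) - P.L j * (1 - x)) with h | h
    · rw [max_eq_right h]
      refine pow_le_pow_left₀ h ?_ 2
      nlinarith
    · rw [max_eq_left h, zero_pow two_ne_zero]; positivity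
  · have hkeq : inner ℝ y (P.tilt j x) = P.qm j x * inner ℝ y (P.nm j) := by
      rw [tilt, hp, zero_smul, zero_add, inner_smul_right]
    rw [← hkeq, hp, zero_mul, max_eq_left (by nlinarith : -0 - P.L j * (1 - x) ≤ 0),
      zero_pow two_ne_zero, add_zero]
    rcases le_total 0 (inner ℝ y (P.tilt j x) - P.L j * x) with h | h
    · rw [max_eq_right h, ← neg_sq (P.L j * (x - x₀) - _)]
      refine pow_le_pow_left₀ h ?_ 2
      nlinarith
    · rw [max_eq_left h, zero_pow two_ne_zero]; positivity

/-- First variation: otherwise a small step forward on the edge would come closer to `X`. -/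
theorem inner_u_nonpos_of_nearest {X : E} {j : ℤ} {x₀ : ℝ} (h0 : 0 ≤ x₀) (h1 : x₀ < 1)
    (hmin : ∀ x ∈ Set.Icc (0 : ℝ) 1, ‖X - P.edgeK j x₀‖ ≤ ‖X - P.edgeK j x‖) :
    inner ℝ (X - P.edgeK j x₀) (P.u j) ≤ 0 := by
  have hL := P.L_pos j
  by_contra! h
  set d := inner ℝ (X - P.edgeK j x₀) (P.u j)
  set ε := min (1 - x₀) (d / P.L j) with hε
  have hε0 : 0 < ε := lt_min (by linarith) (div_pos h hL)
  have hε1 : ε ≤ 1 - x₀ := min_le_left _ _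
  have hε2 : P.L j * ε ≤ d := by
    have : ε ≤ d / P.L j := min_le_right _ _
    rw [le_div_iff₀ hL] at this
    linarith
  have h2 := hmin (x₀ + ε) ⟨by linarith, by linarith⟩
  have e : X - P.edgeK j (x₀ + ε) = (X - P.edgeK j x₀) - (P.L j * ε) • P.u j := by
    simp only [edgeK]; module
  have h3 : ‖X - P.edgeK j x₀‖ ^ 2 ≤ ‖X - P.edgeK j (x₀ + ε)‖ ^ 2 := by gcongr
  rw [e, norm_sub_sq_real (X - _), inner_smul_right, norm_smul, P.norm_u, Real.norm_eq_abs, mul_one,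
    sq_abs] at h3
  have h4 : 0 < P.L j * ε := mul_pos hL hε0
  nlinarith

theorem inner_u_nonneg_of_nearest {X : E} {j : ℤ} {x₀ : ℝ} (h0 : 0 < x₀) (h1 : x₀ ≤ 1)
    (hmin : ∀ x ∈ Set.Icc (0 : ℝ) 1, ‖X - P.edgeK j x₀‖ ≤ ‖X - P.edgeK j x‖) :
    0 ≤ inner ℝ (X - P.edgeK j x₀) (P.u j) := by
  have hL := P.L_pos j
  by_contra! h
  set d := inner ℝ (X - P.edgeK j x₀) (P.u j)
  set ε := min x₀ (-d / P.L j) with hε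
  have hε0 : 0 < ε := lt_min h0 (div_pos (by linarith) hL)
  have hε1 : ε ≤ x₀ := min_le_left _ _
  have hε2 : P.L j * ε ≤ -d := by
    have : ε ≤ -d / P.L j := min_le_right _ _
    rw [le_div_iff₀ hL] at this
    linarith
  have h2 := hmin (x₀ - ε) ⟨by linarith, by linarith⟩
  have e : X - P.edgeK j (x₀ - ε) = (X - P.edgeK j x₀) + (P.L j * ε) • P.u j := by
    simp only [edgeK]; module
  have h3 : ‖X - P.edgeK j x₀‖ ^ 2 ≤ ‖X - P.edgeK j (x₀ - ε)‖ ^ 2 := by gcongr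
  rw [e, norm_add_sq_real, inner_smul_right, norm_smul, P.norm_u, Real.norm_eq_abs, mul_one,
    sq_abs] at h3
  have h4 : 0 < P.L j * ε := mul_pos hL hε0
  nlinarith

/-- The reflection in the bisecting plane takes the nearest point to the ray of the next edge. If
the image lies on that edge, it is no closer to `X`, so `X` is on the near side of the plane. -/
theorem inner_edgeτ_one_nonpos {r : ℝ} (hr : r < P.R) {X : E} {j : ℤ} {x₀ : ℝ} (h0 : 0 ≤ x₀)
    (h1 : x₀ < 1) (hX : ‖X - P.edgeK j x₀‖ ≤ r)
    (hmin : ∀ t, ‖X - P.edgeK j x₀‖ ≤ ‖X - P.K t‖) :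
    inner ℝ (X - P.edgeK j 1) (P.edgeτ j 1) ≤ 0 := by
  have hL := P.L_pos j
  have hL' := P.L_pos (j + 1)
  have hu := inner_u_nonpos_of_nearest h0 h1 fun x hx => by
    rw [← P.K_eq j hx.1 hx.2]; exact hmin _
  set s := P.L j * (1 - x₀) with hs
  have hs0 : 0 < s := mul_pos hL (by linarith)
  rcases le_or_gt s (P.L (j + 1)) with h | h
  · have h2 := hmin ((j + 1 : ℤ) + s / P.L (j + 1))
    rw [P.K_eq (j + 1) (by positivity) ((div_le_one hL').2 h)] at h2
    have e1 : X - P.edgeK j x₀ = (X - P.edgeK j 1) + s • P.u j := by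
      simp only [edgeK, hs]; module
    have e2 : X - P.edgeK (j + 1) (s / P.L (j + 1)) = (X - P.edgeK j 1) - s • P.u (j + 1) := by
      simp only [edgeK, P.V_succ, mul_div_cancel₀ s hL'.ne']; module
    rw [e1, e2] at h2
    have h3 := pow_le_pow_left₀ (norm_nonneg _) h2 2
    rw [norm_add_sq_real, norm_sub_sq_real (X - _), norm_smul, norm_smul, P.norm_u, P.norm_u,
      inner_smul_right, inner_smul_right] at h3
    rw [edgeτ_one, inner_smul_right, inner_add_right]
    have hc : 0 ≤ (1 + inner ℝ (P.u j) (P.u (j + 1)))⁻¹ :=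
      inv_nonneg.2 (by linarith [P.neg_one_lt_inner j])
    refine mul_nonpos_of_nonneg_of_nonpos hc ?_
    nlinarith
  -- The next edge is too short to contain the reflected point. Then the nearest point is more than
  -- `2 * R * T` before the vertex, which outweighs the tilt contribution of at most `r * T`.
  · have e1 : X - P.edgeK j 1 = (X - P.edgeK j x₀) - s • P.u j := by
      simp only [edgeK, hs]; module
    have h2 : inner ℝ (X - P.edgeK j x₀) (P.np j) ≤ r := by
      refine (real_inner_le_norm _ _).trans ?_
      nlinarith [norm_nonneg (X - P.edgeK j x₀), norm_nonneg (P.np j), P.norm_np_le j]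
    rw [edgeτ, tilt_one, e1, inner_sub_left (X - _)]
    simp only [inner_add_right, inner_smul_left, inner_smul_right,
      inner_self_one (P.norm_u j), P.inner_u_np]
    simp only [conj_trivial]
    have h3 := P.lt_length_succ j
    rw [← T] at h3
    have h4 := P.T_nonneg j
    have h5 := P.R_pos
    nlinarith

theorem inner_edgeτ_zero_nonneg {r : ℝ} (hr : r < P.R) {X : E} {j : ℤ} {x₀ : ℝ} (h0 : 0 < x₀)
    (h1 : x₀ ≤ 1) (hX : ‖X - P.edgeK (j + 1) x₀‖ ≤ r)
    (hmin : ∀ t, ‖X - P.edgeK (j + 1) x₀‖ ≤ ‖X - P.K t‖) :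
    0 ≤ inner ℝ (X - P.edgeK (j + 1) 0) (P.edgeτ (j + 1) 0) := by
  have hL := P.L_pos (j + 1)
  have hL' := P.L_pos j
  have hu := inner_u_nonneg_of_nearest h0 h1 fun x hx => by
    rw [← P.K_eq (j + 1) hx.1 hx.2]; exact hmin _
  set s := P.L (j + 1) * x₀ with hs
  have hs0 : 0 < s := mul_pos hL h0
  rcases le_or_gt s (P.L j) with h | h
  · have h2 := hmin (j + (1 - s / P.L j))
    rw [P.K_eq j (sub_nonneg.2 ((div_le_one hL').2 h)) (by linarith [div_pos hs0 hL'])] at h2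
    have e1 : X - P.edgeK (j + 1) x₀ = (X - P.edgeK (j + 1) 0) - s • P.u (j + 1) := by
      simp only [edgeK, hs]; module
    have e2 : X - P.edgeK j (1 - s / P.L j) = (X - P.edgeK (j + 1) 0) + s • P.u j := by
      simp only [edgeK, P.V_succ, mul_sub, mul_div_cancel₀ s hL'.ne']; module
    rw [e1, e2] at h2
    have h3 := pow_le_pow_left₀ (norm_nonneg _) h2 2
    rw [norm_add_sq_real, norm_sub_sq_real (X - _), norm_smul, norm_smul, P.norm_u, P.norm_u,
      inner_smul_right, inner_smul_right] at h3
    rw [edgeτ_zero, inner_smul_right, inner_add_right]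
    have hc : 0 ≤ (1 + inner ℝ (P.u j) (P.u (j + 1)))⁻¹ :=
      inv_nonneg.2 (by linarith [P.neg_one_lt_inner j])
    refine mul_nonneg hc ?_
    nlinarith
  · have e1 : X - P.edgeK (j + 1) 0 = (X - P.edgeK (j + 1) x₀) + s • P.u (j + 1) := by
      simp only [edgeK, hs]; module
    have h2 : -r ≤ inner ℝ (X - P.edgeK (j + 1) x₀) (P.nm (j + 1)) := by
      refine le_trans ?_ (neg_le_of_abs_le (abs_real_inner_le_norm _ _))
      nlinarith [norm_nonneg (X - P.edgeK (j + 1) x₀), norm_nonneg (P.nm (j + 1)),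
        P.norm_nm_le (j + 1)]
    rw [edgeτ, tilt_zero, e1]
    simp only [inner_add_left, inner_add_right, inner_smul_left, inner_smul_right,
      inner_self_one (P.norm_u (j + 1)), P.inner_u_nm]
    simp only [conj_trivial]
    have h3 := P.lt_length j
    rw [← T] at h3
    have h4 := P.T_nonneg j
    have h5 := P.R_pos
    nlinarith

/-- A point at distance at most `r` from the polygon lies in some cross-section. -/
theorem exists_inLeaf_of_nearest {r : ℝ} (hr : r < P.R) {X : E} {t₀ : ℝ}
    (hX : ‖X - P.K t₀‖ ≤ r) (hmin : ∀ t, ‖X - P.K t₀‖ ≤ ‖X - P.K t‖) :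
    ∃ t, P.InLeaf r t X := by
  have hr0 : 0 ≤ r := (norm_nonneg _).trans hX
  obtain ⟨j, x₀, h0, h1, rfl⟩ := exists_int_add t₀
  obtain ⟨i, rfl⟩ : ∃ i, j = i + 1 := ⟨j - 1, by ring⟩
  rw [P.K_eq _ h0 h1.le] at hX hmin
  have he := inner_edgeτ_one_nonpos hr h0 h1 hX hmin
  rcases h0.eq_or_lt with rfl | h0
  -- The nearest point is a vertex; the side of the bisecting plane on which `X` lies decides which
  -- of the two edges to use.
  · rcases le_total 0 (inner ℝ (X - P.edgeK (i + 1) 0) (P.edgeτ (i + 1) 0)) with h | h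
    · exact exists_inLeaf_of_sign hr0 (i + 1) le_rfl zero_le_one hX h he
    · rw [← P.edgeτ_glue, ← P.edgeK_glue] at h
      rw [← P.edgeK_glue] at hX hmin
      obtain ⟨k, rfl⟩ : ∃ k, i = k + 1 := ⟨i - 1, by ring⟩
      exact exists_inLeaf_of_sign hr0 (k + 1) zero_le_one le_rfl hX
        (inner_edgeτ_zero_nonneg hr one_pos le_rfl hX hmin) h
  · exact exists_inLeaf_of_sign hr0 (i + 1) h0.le h1.le hX
      (inner_edgeτ_zero_nonneg hr h0 h1.le hX hmin) he

end ThickPolygon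
end PolygonalKnot
end

/-! ### Assembling leaves into a solid torus. -/

noncomputable section

open Real InnerProductGeometry

namespace PolygonalKnot

/-- A periodic family of embedded planes, whose points are graded by a radial function `e`,
sweeps out a solid torus if its parts `e ≤ r` are disjoint. -/
theorem exists_embedding_of_leaves {E : Type*} [TopologicalSpace E] [T2Space E] {N r : ℝ}
    (hN : 0 < N) (hr : 0 < r) (Φ : ℝ → ℂ → E) (e : ℝ → ℂ → ℝ)
    (hΦ : Continuous fun p : ℝ × ℂ => Φ p.1 p.2) (he : Continuous fun p : ℝ × ℂ => e p.1 p.2)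
    (hΦN : ∀ t, Φ (t + N) = Φ t) (heN : ∀ t, e (t + N) = e t) (he0 : ∀ t, e t 0 = 0)
    (hmono : ∀ t z, z ≠ 0 → StrictMonoOn (fun c : ℝ => e t (c • z)) (Set.Ici 0))
    (hle : ∀ t z, ‖z‖ ≤ e t z)
    (hdisj : ∀ t t' z z', e t z ≤ r → e t' z' ≤ r → Φ t z = Φ t' z' →
      (t : AddCircle N) = (t' : AddCircle N))
    (hinj : ∀ t, Function.Injective (Φ t)) :
    ∃ h : Circle × Metric.closedBall (0 : ℂ) 1 → E, Topology.IsEmbedding h ∧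
      Set.range h = {X | ∃ t z, e t z ≤ r ∧ Φ t z = X} ∧
      h '' {p | (p.2 : ℂ) = 0} = Set.range fun t => Φ t 0 := by
  have : Fact (0 < N) := ⟨hN⟩
  have hΦper : Function.Periodic Φ N := hΦN
  have heper : Function.Periodic e N := heN
  set Φ' : AddCircle N → ℂ → E := hΦper.lift with hΦ'
  set e' : AddCircle N → ℂ → ℝ := heper.lift with he'
  have hq : Topology.IsQuotientMap (Prod.map ((↑) : ℝ → AddCircle N) (id : ℂ → ℂ)) :=
    (QuotientAddGroup.isOpenQuotientMap_mk.prodMap IsOpenQuotientMap.id).isQuotientMap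
  have hΦc : Continuous fun p : AddCircle N × ℂ => Φ' p.1 p.2 := hq.continuous_iff.2 hΦ
  have hec : Continuous fun p : AddCircle N × ℂ => e' p.1 p.2 := hq.continuous_iff.2 he
  have he0' : ∀ s, e' s 0 = 0 := fun s => QuotientAddGroup.induction_on s he0
  have hle' : ∀ s z, ‖z‖ ≤ e' s z := fun s => QuotientAddGroup.induction_on s hle
  have hmono' : ∀ s z, z ≠ 0 → StrictMonoOn (fun c : ℝ => e' s (c • z)) (Set.Ici 0) :=
    fun s => QuotientAddGroup.induction_on s hmono
  set S : Set (AddCircle N × ℂ) := {p | e' p.1 p.2 ≤ r} with hS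
  have hSc : IsCompact S := by
    refine (isCompact_univ.prod (isCompact_closedBall (0 : ℂ) r)).of_isClosed_subset
      (isClosed_le hec continuous_const) ?_
    rintro ⟨s, z⟩ h
    exact ⟨Set.mem_univ _, by simpa using (hle' s z).trans h⟩
  have : CompactSpace S := isCompact_iff_compactSpace.1 hSc
  -- Radial rescaling that turns the region `e' ≤ r` of each plane into the unit disc. At the origin
  -- the quotient has a default value, but the factor `p.2` vanishes.
  set g : AddCircle N × ℂ → ℂ := fun p => (e' p.1 p.2 / (r * ‖p.2‖)) • p.2 with hg
  have hgn : ∀ p, ‖g p‖ = e' p.1 p.2 / r := by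
    rintro ⟨s, z⟩
    by_cases hz : z = 0
    · simp [hg, hz, he0']
    · have hz' : ‖z‖ ≠ 0 := norm_ne_zero_iff.2 hz
      have h1 : 0 ≤ e' s z := (norm_nonneg z).trans (hle' s z)
      simp only [hg, norm_smul, Real.norm_eq_abs]
      rw [abs_of_nonneg (by positivity)]
      field_simp
  have hgc : Continuous g := by
    rw [continuous_iff_continuousAt]
    rintro ⟨s, z⟩
    by_cases hz : z = 0
    · subst hz
      have h0 : g (s, 0) = 0 := by simp [hg]
      rw [ContinuousAt, h0, tendsto_zero_iff_norm_tendsto_zero]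
      simp only [hgn]
      have : Continuous fun p : AddCircle N × ℂ => e' p.1 p.2 / r := hec.div_const r
      have h2 := this.tendsto (s, 0)
      simpa only [he0', zero_div] using h2
    · have hz' : r * ‖z‖ ≠ 0 := mul_ne_zero hr.ne' (norm_ne_zero_iff.2 hz)
      exact (hec.continuousAt.div (by fun_prop) hz').smul continuousAt_snd
  set G : S → AddCircle N × Metric.closedBall (0 : ℂ) 1 := fun p =>
    (p.1.1, ⟨g p.1, by
      rw [mem_closedBall_zero_iff, hgn, div_le_one hr]; exact p.2⟩) with hG
  have hGc : Continuous G := by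
    refine (continuous_fst.comp continuous_subtype_val).prodMk ?_
    exact (hgc.comp continuous_subtype_val).subtype_mk _
  have hGb : Function.Bijective G := by
    constructor
    · rintro ⟨⟨s, z⟩, hz⟩ ⟨⟨s', z'⟩, hz'⟩ h
      rw [hG, Prod.mk.injEq, Subtype.mk.injEq] at h
      obtain ⟨h1, h2⟩ := h
      simp only at h1 h2
      subst h1
      have h3 : e' s z = e' s z' := by
        have := congrArg norm h2
        rw [hgn, hgn] at this
        field_simp at this
        exact this
      by_cases hz0 : z = 0
      · subst hz0
        have : ‖z'‖ ≤ 0 := by rw [← he0' s, h3]; exact hle' _ _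
        rw [norm_le_zero_iff] at this
        subst this; rfl
      · have hzn : 0 < ‖z‖ := norm_pos_iff.2 hz0
        have hepos : 0 < e' s z := hzn.trans_le (hle' s z)
        have hz0' : z' ≠ 0 := by
          rintro rfl
          rw [he0'] at h3; linarith
        have hzn' : 0 < ‖z'‖ := norm_pos_iff.2 hz0'
        simp only [hg, ← h3] at h2
        have h4 : z' = (‖z'‖ / ‖z‖) • z := by
          have := congrArg (fun w => (r * ‖z'‖ / e' s z) • w) h2
          simp only [smul_smul] at this
          have e1 : r * ‖z'‖ / e' s z * (e' s z / (r * ‖z'‖)) = 1 := by field_simp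
          have e2 : r * ‖z'‖ / e' s z * (e' s z / (r * ‖z‖)) = ‖z'‖ / ‖z‖ := by field_simp
          rw [e1, e2, one_smul] at this
          exact this.symm
        have h5 : ‖z'‖ / ‖z‖ = 1 := by
          refine (hmono' s z hz0).injOn (Set.mem_Ici.2 (by positivity))
            (Set.mem_Ici.2 zero_le_one) ?_
          simp only [one_smul]
          rw [← h4, h3]
        rw [h5, one_smul] at h4
        subst h4; rfl
    · rintro ⟨s, ζ, hζ⟩
      rw [mem_closedBall_zero_iff] at hζ
      by_cases h0 : ζ = 0
      · refine ⟨⟨(s, 0), by simp [hS, he0', hr.le]⟩, ?_⟩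
        simp [hG, hg, h0]
      · have hζ0 : 0 < ‖ζ‖ := norm_pos_iff.2 h0
        have hcc : Continuous fun c : ℝ => e' s (c • ζ) :=
          hec.comp (continuous_const.prodMk (continuous_id.smul continuous_const))
        -- The bound `‖z‖ ≤ e' s z` at `r • ζ` ensures that the radius needed is attained for some
        -- scaling in `[0, r]`.
        obtain ⟨c, ⟨hc0, -⟩, hc⟩ := intermediate_value_Icc hr.le hcc.continuousOn
          (show r * ‖ζ‖ ∈ Set.Icc _ _ from ⟨by simp only [zero_smul, he0']; positivity, by
            refine le_trans (le_of_eq ?_) (hle' _ _)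
            rw [norm_smul, Real.norm_of_nonneg hr.le]⟩)
        simp only at hc
        have hcpos : 0 < c := by
          rcases hc0.eq_or_lt with rfl | h
          · rw [zero_smul, he0'] at hc
            have : 0 < r * ‖ζ‖ := by positivity
            linarith
          · exact h
        refine ⟨⟨(s, c • ζ), ?_⟩, ?_⟩
        · change e' s (c • ζ) ≤ r
          rw [hc]; nlinarith
        · simp only [hG, hg, Prod.mk.injEq, true_and, Subtype.mk.injEq, hc, smul_smul, norm_smul,
            Real.norm_of_nonneg hc0]
          have : r * ‖ζ‖ / (r * (c * ‖ζ‖)) * c = 1 := by field_simp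
          rw [this, one_smul]
  set H : S ≃ₜ AddCircle N × Metric.closedBall (0 : ℂ) 1 :=
    Continuous.homeoOfEquivCompactToT2 (f := Equiv.ofBijective G hGb) hGc with hH
  have hHG : ∀ p, H p = G p := fun p => rfl
  set φ : S → E := fun p => Φ' p.1.1 p.1.2 with hφ
  have hφe : Topology.IsClosedEmbedding φ := by
    refine Continuous.isClosedEmbedding (hΦc.comp continuous_subtype_val) ?_
    rintro ⟨⟨s, z⟩, hz⟩ ⟨⟨s', z'⟩, hz'⟩ h
    obtain ⟨t, rfl⟩ := QuotientAddGroup.mk_surjective s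
    obtain ⟨t', rfl⟩ := QuotientAddGroup.mk_surjective s'
    have h1 := hdisj t t' z z' hz hz' h
    have h2 : z = z' := by
      have h3 : Φ t' = Φ t := by
        change Φ' (t' : AddCircle N) = Φ' (t : AddCircle N); rw [h1]
      change Φ t z = Φ t' z' at h
      rw [h3] at h
      exact hinj t h
    rw [Subtype.mk.injEq, Prod.mk.injEq]
    exact ⟨h1, h2⟩
  set C : Circle × Metric.closedBall (0 : ℂ) 1 ≃ₜ S :=
    ((AddCircle.homeomorphCircle hN.ne').symm.prodCongr (Homeomorph.refl _)).trans H.symm with hC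
  refine ⟨φ ∘ C, hφe.isEmbedding.comp C.isEmbedding, ?_, ?_⟩
  · rw [Set.range_comp, C.surjective.range_eq, Set.image_univ]
    ext X
    constructor
    · rintro ⟨⟨⟨s, z⟩, hz⟩, rfl⟩
      obtain ⟨t, rfl⟩ := QuotientAddGroup.mk_surjective s
      exact ⟨t, z, hz, rfl⟩
    · rintro ⟨t, z, hz, rfl⟩
      exact ⟨⟨((t : AddCircle N), z), hz⟩, rfl⟩
  · have key : ∀ p : S, ((G p).2 : ℂ) = 0 ↔ p.1.2 = 0 := by
      rintro ⟨⟨s, z⟩, hz⟩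
      simp only [hG]
      rw [← norm_eq_zero, hgn, div_eq_zero_iff, or_iff_left hr.ne']
      constructor
      · intro h
        have := hle' s z
        simp only at h
        rw [h] at this
        exact norm_le_zero_iff.1 this
      · rintro rfl; exact he0' s
    have hC2 : ∀ q, (G (C q)).2 = q.2 := fun q => by
      have : H (C q) = ((AddCircle.homeomorphCircle hN.ne').symm q.1, q.2) := by
        rw [hC, Homeomorph.trans_apply, Homeomorph.apply_symm_apply]; rfl
      rw [← hHG, this]
    ext X
    constructor
    · rintro ⟨q, hq0, rfl⟩
      have h1 : ((G (C q)).2 : ℂ) = 0 := by rw [hC2]; exact hq0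
      rw [key] at h1
      obtain ⟨t, ht⟩ := QuotientAddGroup.mk_surjective (C q).1.1
      refine ⟨t, ?_⟩
      simp only [Function.comp, hφ, h1, ← ht]
      rfl
    · rintro ⟨t, rfl⟩
      have hmem : ((t : AddCircle N), (0 : ℂ)) ∈ S := by
        change e' _ _ ≤ r; rw [he0']; exact hr.le
      refine ⟨C.symm ⟨_, hmem⟩, ?_, ?_⟩
      · change ((C.symm ⟨_, hmem⟩).2 : ℂ) = 0
        rw [← hC2, C.apply_symm_apply, key]
      · simp only [Function.comp, C.apply_symm_apply]; rfl

/-! ### Cross products and oriented frames. -/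

/-- The cross product. -/
def cross (a b : E3) : E3 :=
  !₂[a 1 * b 2 - a 2 * b 1, a 2 * b 0 - a 0 * b 2, a 0 * b 1 - a 1 * b 0]

theorem inner_eq_sum (a b : E3) : inner ℝ a b = a 0 * b 0 + a 1 * b 1 + a 2 * b 2 := by
  simp [PiLp.inner_apply, Fin.sum_univ_three, mul_comm]

theorem inner_cross_left (a b : E3) : inner ℝ a (cross a b) = 0 := by
  rw [inner_eq_sum]; simp [cross]; ring

theorem inner_cross_right (a b : E3) : inner ℝ b (cross a b) = 0 := by
  rw [inner_eq_sum]; simp [cross]; ring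

theorem norm_cross {a b : E3} (ha : ‖a‖ = 1) (hab : inner ℝ a b = 0) : ‖cross a b‖ = ‖b‖ := by
  have h1 := inner_self_one ha
  have h2 : inner ℝ (cross a b) (cross a b) = inner ℝ b b := by
    rw [inner_eq_sum] at h1 hab ⊢
    rw [inner_eq_sum]
    simp [cross]
    linear_combination (b 0 * b 0 + b 1 * b 1 + b 2 * b 2) * h1 -
      (a 0 * b 0 + a 1 * b 1 + a 2 * b 2) * hab
  rw [real_inner_self_eq_norm_sq, real_inner_self_eq_norm_sq] at h2
  exact (pow_left_inj₀ (norm_nonneg _) (norm_nonneg _) two_ne_zero).1 h2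

theorem cross_cross {a b : E3} (ha : ‖a‖ = 1) (hab : inner ℝ a b = 0) :
    cross a (cross a b) = -b := by
  have h1 := inner_self_one ha
  rw [inner_eq_sum] at h1 hab
  ext i
  fin_cases i <;> simp [cross]
  · linear_combination a 0 * hab - b 0 * h1
  · linear_combination a 1 * hab - b 1 * h1
  · linear_combination a 2 * hab - b 2 * h1

theorem cross_add (a b c : E3) : cross a (b + c) = cross a b + cross a c := by
  ext i; fin_cases i <;> simp [cross] <;> ring

theorem cross_smul (a : E3) (s : ℝ) (b : E3) : cross a (s • b) = s • cross a b := by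
  ext i; fin_cases i <;> simp [cross] <;> ring

/-- For unit vectors `u` and `u'`, the reflection that takes `u` to `-u'`, restricted to the
orthogonal complement of `u`. -/
def transfer (u u' y : E3) : E3 := y - (inner ℝ y u' / (1 + inner ℝ u u')) • (u + u')

/-- A reflection reverses cross products, and this one takes `u` to `-u'`; the two signs cancel.
Hence the transfer preserves orientation, and frames differ by rotations only. -/
theorem cross_transfer {u u' y : E3} (hu : ‖u‖ = 1) (hu' : ‖u'‖ = 1) (hc : -1 < inner ℝ u u')
    (hy : inner ℝ u y = 0) : transfer u u' (cross u y) = cross u' (transfer u u' y) := by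
  have h1 := inner_self_one hu
  have h2 := inner_self_one hu'
  have h3 : (1 + inner ℝ u u') ≠ (0 : ℝ) := by linarith
  set k : ℝ := (1 + inner ℝ u u')⁻¹ with hk
  have h4 : k * (1 + inner ℝ u u') = 1 := inv_mul_cancel₀ h3
  simp only [transfer, div_eq_mul_inv, ← hk]
  clear_value k
  rw [inner_eq_sum] at h1 h2 hy h4
  rw [inner_eq_sum, inner_eq_sum]
  ext i
  fin_cases i <;> simp [cross]
  · linear_combination -k * (y 1 * u' 2 - y 2 * u' 1) * h1 - k * (u' 1 * u 2 - u' 2 * u 1) * hy -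
      k * (u 1 * y 2 - u 2 * y 1) * h2 - ((u 1 * y 2 - u 2 * y 1) + (y 1 * u' 2 - y 2 * u' 1)) * h4
  · linear_combination -k * (y 2 * u' 0 - y 0 * u' 2) * h1 - k * (u' 2 * u 0 - u' 0 * u 2) * hy -
      k * (u 2 * y 0 - u 0 * y 2) * h2 - ((u 2 * y 0 - u 0 * y 2) + (y 2 * u' 0 - y 0 * u' 2)) * h4
  · linear_combination -k * (y 0 * u' 1 - y 1 * u' 0) * h1 - k * (u' 0 * u 1 - u' 1 * u 0) * hy -
      k * (u 0 * y 1 - u 1 * y 0) * h2 - ((u 0 * y 1 - u 1 * y 0) + (y 0 * u' 1 - y 1 * u' 0)) * h4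

theorem norm_transfer {u u' y : E3} (hu : ‖u‖ = 1) (hu' : ‖u'‖ = 1) (hc : -1 < inner ℝ u u')
    (hy : inner ℝ u y = 0) : ‖transfer u u' y‖ = ‖y‖ := by
  have h3 : (1 + inner ℝ u u') ≠ (0 : ℝ) := by linarith
  have h : ‖transfer u u' y‖ ^ 2 = ‖y‖ ^ 2 := by
    rw [← real_inner_self_eq_norm_sq, ← real_inner_self_eq_norm_sq]
    rw [real_inner_comm] at hy
    simp only [transfer, inner_sub_left, inner_sub_right, inner_smul_left, inner_smul_right,
      inner_add_left, inner_add_right, inner_self_one hu, inner_self_one hu', hy,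
      real_inner_comm u u', real_inner_comm y u, real_inner_comm y u']
    simp only [conj_trivial]
    field_simp
    ring
  exact (pow_left_inj₀ (norm_nonneg _) (norm_nonneg _) two_ne_zero).1 h

theorem inner_transfer {u u' y : E3} (hu' : ‖u'‖ = 1) (hc : -1 < inner ℝ u u') :
    inner ℝ u' (transfer u u' y) = 0 := by
  have h3 : (1 + inner ℝ u u') ≠ (0 : ℝ) := by linarith
  simp only [transfer, inner_sub_right, inner_smul_right, inner_add_right, inner_self_one hu',
    real_inner_comm u u', real_inner_comm u' y]
  field_simp
  ring

/-- An oriented isometric identification of `ℂ` with the orthogonal complement of `u`. -/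
structure IsFrame (u : E3) (F : ℂ →ₗ[ℝ] E3) : Prop where
  norm_map : ∀ z, ‖F z‖ = ‖z‖
  inner_map : ∀ z, inner ℝ u (F z) = 0
  surj : ∀ y, inner ℝ u y = 0 → ∃ z, F z = y
  map_I_mul : ∀ z, F (Complex.I * z) = cross u (F z)

theorem exists_unit_orthogonal {u : E3} (hu : ‖u‖ = 1) : ∃ w : E3, ‖w‖ = 1 ∧ inner ℝ u w = 0 := by
  have hf : Fact (Module.finrank ℝ E3 = 2 + 1) := ⟨by simp⟩
  have hu0 : u ≠ 0 := by rintro rfl; simp at hu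
  have h2 := Submodule.finrank_orthogonal_span_singleton (𝕜 := ℝ) (n := 2) hu0
  have : Nontrivial (ℝ ∙ u)ᗮ := Module.nontrivial_of_finrank_pos (R := ℝ) (by omega)
  obtain ⟨w, hw⟩ := exists_norm_eq (ℝ ∙ u)ᗮ (zero_le_one (α := ℝ))
  exact ⟨w, hw, Submodule.mem_orthogonal_singleton_iff_inner_right.1 w.2⟩

theorem exists_isFrame {u : E3} (hu : ‖u‖ = 1) : ∃ F, IsFrame u F := by
  obtain ⟨w, hw, huw⟩ := exists_unit_orthogonal hu
  let F : ℂ →ₗ[ℝ] E3 := Complex.reLm.smulRight w + Complex.imLm.smulRight (cross u w)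
  have hF : ∀ z : ℂ, F z = z.re • w + z.im • cross u w := fun z => rfl
  have hnorm : ∀ z, ‖F z‖ = ‖z‖ := fun z => by
    refine (pow_left_inj₀ (norm_nonneg _) (norm_nonneg _) two_ne_zero).1 ?_
    rw [hF, norm_add_sq_real, inner_smul_left, inner_smul_right, inner_cross_right, norm_smul,
      norm_smul, norm_cross hu huw, hw, ← Complex.normSq_eq_norm_sq, Complex.normSq_apply]
    simp only [Real.norm_eq_abs, mul_one, mul_zero, add_zero, sq_abs]
    ring
  have hin : ∀ z, inner ℝ u (F z) = 0 := fun z => by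
    rw [hF, inner_add_right, inner_smul_right, inner_smul_right, huw, inner_cross_left]; simp
  refine ⟨F, hnorm, hin, ?_, fun z => ?_⟩
  · have hf : Fact (Module.finrank ℝ E3 = 2 + 1) := ⟨by simp⟩
    have hu0 : u ≠ 0 := by rintro rfl; simp at hu
    have h2 := Submodule.finrank_orthogonal_span_singleton (𝕜 := ℝ) (n := 2) hu0
    let F' : ℂ →ₗ[ℝ] (ℝ ∙ u)ᗮ := F.codRestrict _ fun z =>
      Submodule.mem_orthogonal_singleton_iff_inner_right.2 (hin z)
    have hinj : Function.Injective F' := by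
      rw [injective_iff_map_eq_zero]
      intro z hz
      have : ‖F z‖ = 0 := norm_eq_zero.2 (congrArg Subtype.val hz)
      rw [hnorm] at this
      exact norm_eq_zero.1 this
    have hsurj := (LinearMap.injective_iff_surjective_of_finrank_eq_finrank
      (by rw [Complex.finrank_real_complex]; exact h2.symm)).1 hinj
    intro y hy
    obtain ⟨z, hz⟩ := hsurj ⟨y, Submodule.mem_orthogonal_singleton_iff_inner_right.2 hy⟩
    exact ⟨z, congrArg Subtype.val hz⟩
  · rw [hF, hF, cross_add, cross_smul, cross_smul, cross_cross hu huw]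
    simp
    abel

/-- Oriented frames at `u` and `u'` correspond under the transfer up to a rotation. -/
theorem IsFrame.exists_rotation {u u' : E3} (hu : ‖u‖ = 1) (hu' : ‖u'‖ = 1)
    (hc : -1 < inner ℝ u u') {F F' : ℂ →ₗ[ℝ] E3} (hF : IsFrame u F) (hF' : IsFrame u' F') :
    ∃ θ : ℝ, ∀ z, transfer u u' (F (Complex.exp (θ * Complex.I) * z)) = F' z := by
  obtain ⟨w, hw⟩ := hF'.surj _ (inner_transfer (u := u) (y := F 1) hu' hc)
  have hwn : ‖w‖ = 1 := by
    rw [← hF'.norm_map, hw, norm_transfer hu hu' hc (hF.inner_map 1), hF.norm_map, norm_one]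
  have hw0 : w ≠ 0 := by rintro rfl; simp at hwn
  -- The transfer commutes with the quarter turns, so in frame coordinates it is complex linear:
  -- multiplication by a unit complex number `w`.
  have key : ∀ z, transfer u u' (F z) = F' (z * w) := by
    intro z
    have e1 : F z = z.re • F 1 + z.im • cross u (F 1) := by
      rw [← hF.map_I_mul, ← map_smul, ← map_smul, ← map_add]
      congr 1
      apply Complex.ext <;> simp
    have e2 : transfer u u' (z.re • F 1 + z.im • cross u (F 1)) =
        z.re • transfer u u' (F 1) + z.im • transfer u u' (cross u (F 1)) := by
      simp only [transfer, inner_add_left, inner_smul_left, conj_trivial]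
      module
    rw [e1, e2, cross_transfer hu hu' hc (hF.inner_map 1), ← hw, ← hF'.map_I_mul, ← map_smul,
      ← map_smul, ← map_add]
    congr 1
    apply Complex.ext <;> simp
    ring
  have hexp : Complex.exp (Complex.arg w * Complex.I) = w := by
    have := Complex.norm_mul_exp_arg_mul_I w
    rwa [hwn, Complex.ofReal_one, one_mul] at this
  refine ⟨-Complex.arg w, fun z => ?_⟩
  rw [key]
  congr 1
  rw [Complex.ofReal_neg, neg_mul, Complex.exp_neg, hexp]
  field_simp

end PolygonalKnot
end

/-! ### Local minima of the distance, and star-shapedness of leaves. -/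

noncomputable section

open Real InnerProductGeometry

namespace PolygonalKnot

section Ray

variable {E : Type*} [NormedAddCommGroup E] [InnerProductSpace ℝ E]

theorem norm_sub_smul_sq (D w : E) (x : ℝ) :
    ‖D - x • w‖ ^ 2 = ‖D‖ ^ 2 - 2 * x * inner ℝ D w + x ^ 2 * ‖w‖ ^ 2 := by
  rw [norm_sub_sq_real, inner_smul_right, norm_smul, Real.norm_eq_abs, mul_pow, sq_abs]
  ring

theorem inner_nonpos_of_ray_min {D w : E} (hw : w ≠ 0) {δ : ℝ} (hδ : 0 < δ)
    (h : ∀ x, 0 ≤ x → x < δ → ‖D‖ ≤ ‖D - x • w‖) : inner ℝ D w ≤ 0 := by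
  by_contra! hd
  have hw' : 0 < ‖w‖ ^ 2 := by positivity
  set ε := min (δ / 2) (inner ℝ D w / ‖w‖ ^ 2)
  have hε0 : 0 < ε := lt_min (by linarith) (div_pos hd hw')
  have hε1 : ε ≤ δ / 2 := min_le_left _ _
  have hε2 : ε * ‖w‖ ^ 2 ≤ inner ℝ D w := (le_div_iff₀ hw').1 (min_le_right _ _)
  have h1 := pow_le_pow_left₀ (norm_nonneg _) (h ε hε0.le (by linarith)) 2
  rw [norm_sub_smul_sq] at h1
  nlinarith

theorem strictMonoOn_norm_sub_smul {D w : E} (hw : w ≠ 0) (h : inner ℝ D w ≤ 0) :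
    StrictMonoOn (fun x : ℝ => ‖D - x • w‖) (Set.Ici 0) := by
  intro x hx y _ hxy
  have hx : 0 ≤ x := hx
  have hw' : 0 < ‖w‖ ^ 2 := by positivity
  refine lt_of_pow_lt_pow_left₀ 2 (norm_nonneg _) ?_
  simp only [norm_sub_smul_sq]
  have h1 : x ^ 2 * ‖w‖ ^ 2 < y ^ 2 * ‖w‖ ^ 2 := by gcongr
  nlinarith

end Ray

namespace ThickPolygon

variable {E : Type*} [NormedAddCommGroup E] [InnerProductSpace ℝ E] (P : ThickPolygon E)

theorem u_ne_zero (j : ℤ) : P.u j ≠ 0 := by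
  intro h; have := P.norm_u j; simp [h] at this

/-- The squared distance along an edge is a quadratic with positive leading coefficient. A local
minimum makes its initial slope nonnegative, so it increases strictly up to the end of the edge. -/
theorem strictMonoOn_dist_of_isLocalMin {q : E} {s : ℝ}
    (h : IsLocalMin (fun x => dist q (P.K x)) s) :
    ∃ ε > 0, StrictMonoOn (fun x => dist q (P.K x)) (Set.Icc s (s + ε)) := by
  obtain ⟨δ, hδ, hmin⟩ := Metric.eventually_nhds_iff.1 h
  obtain ⟨j, x₀, h0, h1, rfl⟩ := exists_int_add s
  have hL := P.L_pos j
  have hK : ∀ x, 0 ≤ x → x ≤ 1 - x₀ → dist q (P.K (j + x₀ + x)) =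
      ‖(q - P.K (j + x₀)) - x • (P.L j • P.u j)‖ := fun x hx hx1 => by
    rw [dist_eq_norm, add_assoc, P.K_eq j (by linarith) (by linarith), P.K_eq j h0 h1.le]
    congr 1
    simp only [edgeK]; module
  have hw : P.L j • P.u j ≠ 0 := smul_ne_zero hL.ne' (P.u_ne_zero j)
  have hin : inner ℝ (q - P.K (j + x₀)) (P.L j • P.u j) ≤ 0 := by
    refine inner_nonpos_of_ray_min hw (lt_min hδ (sub_pos.2 h1)) fun x hx hx1 => ?_
    have h2 := hmin (y := j + x₀ + x) (by
      rw [Real.dist_eq, add_sub_cancel_left, abs_of_nonneg hx]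
      exact hx1.trans_le (min_le_left _ _))
    beta_reduce at h2
    rwa [hK x hx (hx1.le.trans (min_le_right _ _)), dist_eq_norm] at h2
  refine ⟨1 - x₀, by linarith, ?_⟩
  intro a ha b hb hab
  have := strictMonoOn_norm_sub_smul hw hin (a := a - (j + x₀)) (b := b - (j + x₀))
    (sub_nonneg.2 ha.1) (sub_nonneg.2 hb.1) (by linarith)
  simp only at this
  rw [← hK _ (sub_nonneg.2 ha.1) (by linarith [ha.2]), ← hK _ (sub_nonneg.2 hb.1)
    (by linarith [hb.2])] at this
  simpa only [add_sub_cancel] using this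

theorem strictAntiOn_dist_of_isLocalMin {q : E} {s : ℝ}
    (h : IsLocalMin (fun x => dist q (P.K x)) s) :
    ∃ ε > 0, StrictAntiOn (fun x => dist q (P.K x)) (Set.Icc (s - ε) s) := by
  obtain ⟨δ, hδ, hmin⟩ := Metric.eventually_nhds_iff.1 h
  -- The ceiling puts `s` in a half-open interval with `x₀ > 0`, so that a vertex counts as the end
  -- of the edge before it.
  obtain ⟨j, x₀, h0, h1, rfl⟩ : ∃ (j : ℤ) (x : ℝ), 0 < x ∧ x ≤ 1 ∧ s = j + x :=
    ⟨⌈s⌉ - 1, s - (⌈s⌉ - 1), by linarith [Int.ceil_lt_add_one s], by linarith [Int.le_ceil s],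
      by push_cast; ring⟩
  have hL := P.L_pos j
  have hK : ∀ x, 0 ≤ x → x ≤ x₀ → dist q (P.K (j + x₀ - x)) =
      ‖(q - P.K (j + x₀)) - x • -(P.L j • P.u j)‖ := fun x hx hx1 => by
    rw [dist_eq_norm, add_sub_assoc, P.K_eq j (by linarith) (by linarith), P.K_eq j h0.le h1]
    congr 1
    simp only [edgeK]; module
  have hw : -(P.L j • P.u j) ≠ 0 := neg_ne_zero.2 (smul_ne_zero hL.ne' (P.u_ne_zero j))
  have hin : inner ℝ (q - P.K (j + x₀)) (-(P.L j • P.u j)) ≤ 0 := by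
    refine inner_nonpos_of_ray_min hw (lt_min hδ h0) fun x hx hx1 => ?_
    have h2 := hmin (y := j + x₀ - x) (by
      rw [Real.dist_eq, sub_sub_cancel_left, abs_neg, abs_of_nonneg hx]
      exact hx1.trans_le (min_le_left _ _))
    beta_reduce at h2
    rwa [hK x hx (hx1.le.trans (min_le_right _ _)), dist_eq_norm] at h2
  refine ⟨x₀, h0, ?_⟩
  intro a ha b hb hab
  have := strictMonoOn_norm_sub_smul hw hin (a := (j + x₀) - b) (b := (j + x₀) - a)
    (sub_nonneg.2 hb.2) (sub_nonneg.2 ha.2) (by linarith)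
  simp only at this
  rw [← hK _ (sub_nonneg.2 ha.2) (by linarith [ha.1]), ← hK _ (sub_nonneg.2 hb.2)
    (by linarith [hb.1])] at this
  simpa only [sub_sub_cancel] using this

theorem excess_zero (j : ℤ) {x : ℝ} (h0 : 0 ≤ x) (h1 : x ≤ 1) : P.excess j x 0 = 0 := by
  have hL := P.L_pos j
  have e1 : max 0 (-(P.L j * x)) = 0 := max_eq_left (by nlinarith)
  have e2 : max 0 (-(P.L j * (1 - x))) = 0 := max_eq_left (by nlinarith)
  simp [excess, e1, e2]

/-- Each overshoot `max 0 (c * A - B)` with `B ≥ 0` is nondecreasing in `c ≥ 0`, and the norm is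
strictly increasing. -/
theorem excess_smul_strictMonoOn (j : ℤ) {x : ℝ} (h0 : 0 ≤ x) (h1 : x ≤ 1) {y : E} (hy : y ≠ 0) :
    StrictMonoOn (fun c : ℝ => P.excess j x (c • y)) (Set.Ici 0) := by
  intro c hc d _ hcd
  have hc : 0 ≤ c := hc
  have hd : 0 ≤ d := hc.trans hcd.le
  have hL := P.L_pos j
  have aux : ∀ A B : ℝ, 0 ≤ B → max 0 (c * A - B) ≤ max 0 (d * A - B) := by
    intro A B hB
    rcases le_total 0 A with hA | hA
    · exact max_le_max le_rfl (by nlinarith)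
    · rw [max_eq_left (by nlinarith)]; exact le_max_left _ _
  have e1 := aux (P.qm j x * inner ℝ y (P.nm j)) (P.L j * x) (by positivity)
  have e2 := aux (-(P.qp j x * inner ℝ y (P.np j))) (P.L j * (1 - x))
    (mul_nonneg hL.le (by linarith))
  have e3 : ‖c • y‖ < ‖d • y‖ := by
    rw [norm_smul, norm_smul, Real.norm_of_nonneg hc, Real.norm_of_nonneg hd]
    have : 0 < ‖y‖ := norm_pos_iff.2 hy
    gcongr
  simp only [excess, inner_smul_left, conj_trivial]
  refine sqrt_lt_sqrt (by positivity) ?_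
  have e1' := pow_le_pow_left₀ (le_max_left _ _) e1 2
  have e2' := pow_le_pow_left₀ (le_max_left _ _) e2 2
  have e3' := pow_lt_pow_left₀ e3 (norm_nonneg _) two_ne_zero
  simp only [mul_left_comm _ c, mul_left_comm _ d, mul_neg] at e1' e2' ⊢
  linarith

theorem point_injOn (j : ℤ) (x : ℝ) {y y' : E} (hy : inner ℝ (P.u j) y = 0)
    (hy' : inner ℝ (P.u j) y' = 0) (h : P.point j x y = P.point j x y') : y = y' := by
  have h1 : y - y' = (inner ℝ y (P.tilt j x) - inner ℝ y' (P.tilt j x)) • P.u j := by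
    have := add_left_cancel h
    rw [sub_eq_sub_iff_add_eq_add] at this
    rw [sub_smul, sub_eq_sub_iff_add_eq_add, this]
    abel
  rw [← sub_eq_zero, ← inner_self_eq_zero (𝕜 := ℝ)]
  nth_rewrite 1 [h1]
  rw [inner_smul_left, inner_sub_right, hy, hy', sub_zero, mul_zero]

theorem point_zero (j : ℤ) (x : ℝ) : P.point j x 0 = P.edgeK j x := by simp [point]

end ThickPolygon

/-! ### Gluing the cross-sections at the vertices. -/

section Frames

variable (P : ThickPolygon E3)

namespace ThickPolygon

theorem inner_tilt_one (j : ℤ) {y : E3} (hy : inner ℝ (P.u j) y = 0) :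
    inner ℝ y (P.tilt j 1) = inner ℝ y (P.u (j + 1)) / (1 + inner ℝ (P.u j) (P.u (j + 1))) := by
  rw [real_inner_comm] at hy
  have h := P.edgeτ_one j
  rw [edgeτ] at h
  have h2 := congrArg (inner ℝ y) h
  rw [inner_add_right, inner_smul_right, inner_add_right, hy, zero_add, zero_add] at h2
  rw [h2, div_eq_inv_mul]

theorem inner_tilt_zero_transfer (j : ℤ) {y : E3} (hy : inner ℝ (P.u j) y = 0) :
    inner ℝ (transfer (P.u j) (P.u (j + 1)) y) (P.tilt (j + 1) 0) = -inner ℝ y (P.tilt j 1) := by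
  have hc := P.neg_one_lt_inner j
  have h3 : (1 + inner ℝ (P.u j) (P.u (j + 1))) ≠ (0 : ℝ) := by linarith
  have h := P.edgeτ_zero j
  rw [edgeτ] at h
  have h2 := congrArg (inner ℝ (transfer (P.u j) (P.u (j + 1)) y)) h
  have h4 := inner_transfer (y := y) (P.norm_u (j + 1)) hc
  rw [real_inner_comm] at h4
  rw [inner_add_right, inner_smul_right, inner_add_right, h4, zero_add, add_zero] at h2
  rw [h2, P.inner_tilt_one j hy, transfer]
  rw [real_inner_comm] at hy
  rw [inner_sub_left, inner_smul_left, inner_add_left, hy, inner_self_one (P.norm_u j),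
    real_inner_comm (P.u j) (P.u (j + 1))]
  simp only [conj_trivial]
  field_simp
  ring

/-- A point of the bisecting plane has orthogonal components relative to both edges; `transfer`
takes one to the other. -/
theorem point_glue (j : ℤ) {y : E3} (hy : inner ℝ (P.u j) y = 0) :
    P.point j 1 y = P.point (j + 1) 0 (transfer (P.u j) (P.u (j + 1)) y) := by
  rw [point, point, P.inner_tilt_zero_transfer j hy, P.edgeK_glue, transfer,
    ← P.inner_tilt_one j hy]
  module

theorem excess_glue (j : ℤ) {y : E3} (hy : inner ℝ (P.u j) y = 0) :
    P.excess j 1 y = P.excess (j + 1) 0 (transfer (P.u j) (P.u (j + 1)) y) := by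
  have h := P.inner_tilt_zero_transfer j hy
  have hL := P.L_pos j
  have hsucc := P.L_pos (j + 1)
  rw [tilt_one, tilt_zero, inner_smul_right, inner_smul_right] at h
  have hT : P.qm (j + 1) 0 = P.T j := by rw [qm_zero, add_sub_cancel_right]
  rw [excess, excess, norm_transfer (P.norm_u _) (P.norm_u _) (P.neg_one_lt_inner j) hy,
    qp_one, qm_one, qp_zero, hT, h]
  simp [hL.le, hsucc.le]

/-- The cross-sections of the tube, parametrized by the complex plane by means of frames that
rotate along the edges. -/
def leafMap (F : ℤ → ℂ →ₗ[ℝ] E3) (θ : ℤ → ℝ) (j : ℤ) (x : ℝ) (z : ℂ) : E3 :=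
  P.point j x (F j (Complex.exp ((θ j * x : ℝ) * Complex.I) * z))

/-- The distance from the polygon, in the coordinates of `leafMap`. -/
def leafExcess (F : ℤ → ℂ →ₗ[ℝ] E3) (θ : ℤ → ℝ) (j : ℤ) (x : ℝ) (z : ℂ) : ℝ :=
  P.excess j x (F j (Complex.exp ((θ j * x : ℝ) * Complex.I) * z))

variable {P}
variable {F : ℤ → ℂ →ₗ[ℝ] E3} {θ : ℤ → ℝ}

theorem leafMap_glue (hF : ∀ j, IsFrame (P.u j) (F j))
    (hθ : ∀ j z, transfer (P.u j) (P.u (j + 1)) (F j (Complex.exp (θ j * Complex.I) * z)) =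
      F (j + 1) z) (j : ℤ) : P.leafMap F θ j 1 = P.leafMap F θ (j + 1) 0 := by
  funext z
  rw [leafMap, leafMap, P.point_glue j ((hF j).inner_map _), mul_one, hθ]
  simp

theorem leafExcess_glue (hF : ∀ j, IsFrame (P.u j) (F j))
    (hθ : ∀ j z, transfer (P.u j) (P.u (j + 1)) (F j (Complex.exp (θ j * Complex.I) * z)) =
      F (j + 1) z) (j : ℤ) : P.leafExcess F θ j 1 = P.leafExcess F θ (j + 1) 0 := by
  funext z
  rw [leafExcess, leafExcess, P.excess_glue j ((hF j).inner_map _), mul_one, hθ]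
  simp

theorem continuous_frame_rotation (j : ℤ) :
    Continuous fun p : ℝ × ℂ => F j (Complex.exp ((θ j * p.1 : ℝ) * Complex.I) * p.2) :=
  (F j).continuous_of_finiteDimensional.comp (by fun_prop)

theorem continuous_leafMap (j : ℤ) :
    Continuous fun p : ℝ × ℂ => P.leafMap F θ j p.1 p.2 := by
  have h1 := continuous_frame_rotation (F := F) (θ := θ) j
  have h2 := (P.continuous_tilt j).comp (continuous_fst (X := ℝ) (Y := ℂ))
  unfold leafMap point edgeK
  exact (by fun_prop : Continuous fun p : ℝ × ℂ => P.V j + (P.L j * p.1) • P.u j).add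
    (h1.sub (Continuous.smul (h1.inner (𝕜 := ℝ) h2) continuous_const))

theorem continuous_leafExcess (j : ℤ) :
    Continuous fun p : ℝ × ℂ => P.leafExcess F θ j p.1 p.2 := by
  have h1 := continuous_frame_rotation (F := F) (θ := θ) j
  have h2 := (P.continuous_qp j).comp (continuous_fst (X := ℝ) (Y := ℂ))
  have h3 := (P.continuous_qm j).comp (continuous_fst (X := ℝ) (Y := ℂ))
  have h4 := h1.inner (𝕜 := ℝ) (continuous_const (y := P.nm j))
  have h5 := h1.inner (𝕜 := ℝ) (continuous_const (y := P.np j))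
  unfold leafExcess excess
  refine continuous_sqrt.comp ((((h1.norm).pow 2).add ?_).add ?_)
  · exact (continuous_const.max ((h3.mul h4).sub (by fun_prop))).pow 2
  · exact (continuous_const.max ((h2.mul h5).neg.sub (by fun_prop))).pow 2

/-- The tube around a thick polygon without short doubly critical pairs is a solid torus. -/
theorem exists_embedding {r : ℝ} (hr0 : 0 < r) (hr : r < P.R)
    (hdc : ∀ s t : ℝ, s < t → t < s + P.period → IsLocalMin (fun x => dist (P.K t) (P.K x)) s →
      IsLocalMin (fun x => dist (P.K s) (P.K x)) t → 2 * r < ‖P.K t - P.K s‖)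
    (hF : ∀ j, IsFrame (P.u j) (F j)) (hFN : ∀ j, F (j + P.period) = F j)
    (hθ : ∀ j z, transfer (P.u j) (P.u (j + 1)) (F j (Complex.exp (θ j * Complex.I) * z)) =
      F (j + 1) z) (hθN : ∀ j, θ (j + P.period) = θ j) :
    ∃ h : Circle × Metric.closedBall (0 : ℂ) 1 → E3, Topology.IsEmbedding h ∧
      Set.range h = {X | ∃ t, P.InLeaf r t X} ∧
      h '' {p | (p.2 : ℂ) = 0} = Set.range P.K := by
  have hN : (0 : ℝ) < P.period := by exact_mod_cast P.period_pos
  have hΦeq := fun j x h0 h1 => piecewise_eq (leafMap_glue hF hθ) j (x := x) h0 h1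
  have heeq := fun j x h0 h1 => piecewise_eq (leafExcess_glue hF hθ) j (x := x) h0 h1
  have hΦN : ∀ t, piecewise (P.leafMap F θ) (t + P.period) = piecewise (P.leafMap F θ) t :=
    piecewise_add_period fun j => by
      funext x z
      rw [leafMap, leafMap, point, point, hFN, hθN, P.tilt_periodic, P.u_periodic, edgeK, edgeK,
        P.V_periodic, P.L_periodic, P.u_periodic]
  have heN : ∀ t, piecewise (P.leafExcess F θ) (t + P.period) = piecewise (P.leafExcess F θ) t :=
    piecewise_add_period fun j => by
      funext x z
      rw [leafExcess, leafExcess, excess, excess, hFN, hθN, P.qp_periodic, P.qm_periodic,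
        P.np_periodic, P.nm_periodic, P.L_periodic]
  have hrot : ∀ (j : ℤ) (x : ℝ) (z : ℂ),
      ‖F j (Complex.exp ((θ j * x : ℝ) * Complex.I) * z)‖ = ‖z‖ := fun j x z => by
    rw [(hF j).norm_map, norm_mul, Complex.norm_exp_ofReal_mul_I, one_mul]
  have hleaf : ∀ t z, piecewise (P.leafExcess F θ) t z ≤ r →
      P.InLeaf r t (piecewise (P.leafMap F θ) t z) := fun t z h =>
    ⟨⌊t⌋, Int.fract t, _, Int.fract_nonneg t, (Int.fract_lt_one t).le,
      (Int.floor_add_fract t).symm, (hF _).inner_map _, rfl, h⟩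
  obtain ⟨h, hemb, hrange, hcore⟩ := exists_embedding_of_leaves hN hr0
    (piecewise (P.leafMap F θ)) (piecewise (P.leafExcess F θ))
    (continuous_piecewise_uncurry (leafMap_glue hF hθ) continuous_leafMap)
    (continuous_piecewise_uncurry (leafExcess_glue hF hθ) continuous_leafExcess) hΦN heN
    (fun t => by
      rw [piecewise, leafExcess, mul_zero, map_zero]
      exact P.excess_zero _ (Int.fract_nonneg t) (Int.fract_lt_one t).le)
    (fun t z hz => by
      have hne : F ⌊t⌋ (Complex.exp ((θ ⌊t⌋ * Int.fract t : ℝ) * Complex.I) * z) ≠ 0 := by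
        rw [← norm_ne_zero_iff, hrot]; exact norm_ne_zero_iff.2 hz
      have := P.excess_smul_strictMonoOn ⌊t⌋ (Int.fract_nonneg t) (Int.fract_lt_one t).le hne
      simp only [piecewise, leafExcess, mul_smul_comm, map_smul]
      exact this)
    (fun t z => by
      rw [piecewise, leafExcess, ← hrot ⌊t⌋ (Int.fract t) z]
      exact P.norm_le_excess _ _ _)
    (fun t t' z z' h1 h2 h => by
      -- Shift `t'` by periods into `[t, t + N)`; disjointness of leaves then leaves only equality.
      obtain ⟨k, hk, -⟩ := existsUnique_add_zsmul_mem_Ico hN t' t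
      rw [zsmul_eq_mul] at hk
      have hΦk : piecewise (P.leafMap F θ) (t' + k * P.period) = piecewise (P.leafMap F θ) t' :=
        (show Function.Periodic (piecewise (P.leafMap F θ)) P.period from hΦN).int_mul k t'
      have hek : piecewise (P.leafExcess F θ) (t' + k * P.period) =
          piecewise (P.leafExcess F θ) t' :=
        (show Function.Periodic (piecewise (P.leafExcess F θ)) P.period from heN).int_mul k t'
      have l1 := hleaf t z h1
      have l2 := hleaf (t' + k * P.period) z' (by rw [hek]; exact h2)
      rw [hΦk, ← h] at l2
      rcases hk.1.eq_or_lt with he | hlt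
      · rw [QuotientAddGroup.eq, AddSubgroup.mem_zmultiples_iff]
        exact ⟨-k, by rw [zsmul_eq_mul]; push_cast; linarith⟩
      · exact (l1.false_of_lt hr hdc l2 hlt hk.2).elim)
    (fun t z z' h => by
      have h1 := P.point_injOn _ _ ((hF _).inner_map _) ((hF _).inner_map _) h
      have h2 := hrot ⌊t⌋ (Int.fract t) (z - z')
      rw [mul_sub, map_sub, h1, sub_self, norm_zero] at h2
      exact sub_eq_zero.1 (norm_eq_zero.1 h2.symm))
  refine ⟨h, hemb, ?_, ?_⟩
  · rw [hrange]
    ext X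
    constructor
    · rintro ⟨t, z, hz, rfl⟩
      exact ⟨t, hleaf t z hz⟩
    · rintro ⟨t, j, x, y, h0, h1, rfl, hy, rfl, hle⟩
      obtain ⟨w, rfl⟩ := (hF j).surj y hy
      have hw : Complex.exp ((θ j * x : ℝ) * Complex.I) *
          (Complex.exp (-((θ j * x : ℝ) * Complex.I)) * w) = w := by
        rw [← mul_assoc, ← Complex.exp_add, add_neg_cancel, Complex.exp_zero, one_mul]
      refine ⟨j + x, Complex.exp (-((θ j * x : ℝ) * Complex.I)) * w, ?_, ?_⟩
      · rwa [heeq j x h0 h1, leafExcess, hw]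
      · rw [hΦeq j x h0 h1, leafMap, hw]
  · rw [hcore]
    congr 1
    funext t
    rw [piecewise, leafMap, mul_zero, map_zero, P.point_zero]
    rfl

end ThickPolygon

end Frames

end PolygonalKnot
end

/-! ### Polygonal knots as thick polygons. -/

noncomputable section

open Real InnerProductGeometry

namespace PolygonalKnot

variable {n : ℕ} {v : ZMod n → E3}

theorem IsPolygonalKnot.ne_succ (hv : IsPolygonalKnot v) (i : ZMod n) : v i ≠ v (i + 1) := by
  have : Fact (1 < n) := ⟨by have := hv.three_le; omega⟩
  intro h
  have := hv.injective h
  simp at this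

theorem edgeLength_eq_norm (v : ZMod n → E3) (i : ZMod n) :
    edgeLength v i = ‖v (i + 1) - v i‖ := by
  rw [edgeLength, dist_comm, dist_eq_norm]

theorem IsPolygonalKnot.edgeLength_pos (hv : IsPolygonalKnot v) (i : ZMod n) :
    0 < edgeLength v i := dist_pos.2 (hv.ne_succ i)

/-- Unit direction of the edge `i`. -/
def direction (v : ZMod n → E3) (i : ZMod n) : E3 := (edgeLength v i)⁻¹ • (v (i + 1) - v i)

theorem IsPolygonalKnot.norm_direction (hv : IsPolygonalKnot v) (i : ZMod n) :
    ‖direction v i‖ = 1 := by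
  have h := hv.edgeLength_pos i
  rw [direction, norm_smul, ← edgeLength_eq_norm, norm_inv, Real.norm_of_nonneg h.le,
    inv_mul_cancel₀ h.ne']

theorem IsPolygonalKnot.edgeLength_smul_direction (hv : IsPolygonalKnot v) (i : ZMod n) :
    edgeLength v i • direction v i = v (i + 1) - v i := by
  rw [direction, smul_smul, mul_inv_cancel₀ (hv.edgeLength_pos i).ne', one_smul]

theorem IsPolygonalKnot.angle_direction (hv : IsPolygonalKnot v) (i : ZMod n) :
    angle (direction v i) (direction v (i + 1)) = turningAngle v (i + 1) := by
  rw [direction, direction, angle_smul_left_of_pos _ _ (inv_pos.2 (hv.edgeLength_pos i)),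
    angle_smul_right_of_pos _ _ (inv_pos.2 (hv.edgeLength_pos (i + 1))), turningAngle,
    add_sub_cancel_right]

/-- The content of a lower bound on `rad` at a vertex. -/
theorem IsPolygonalKnot.corner_bounds (hv : IsPolygonalKnot v) {R : ℝ} (i : ZMod n)
    (h : ENNReal.ofReal R < rad v (i + 1)) :
    turningAngle v (i + 1) < π ∧
      2 * R * tan (turningAngle v (i + 1) / 2) < edgeLength v i ∧
      2 * R * tan (turningAngle v (i + 1) / 2) < edgeLength v (i + 1) := by
  by_cases h0 : turningAngle v (i + 1) = 0
  · rw [h0, zero_div, tan_zero, mul_zero]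
    exact ⟨pi_pos, hv.edgeLength_pos _, hv.edgeLength_pos _⟩
  · rw [rad, if_neg h0, ENNReal.ofReal_lt_ofReal_iff', add_sub_cancel_right] at h
    have hα : 0 < turningAngle v (i + 1) := lt_of_le_of_ne (angle_nonneg _ _) (Ne.symm h0)
    have hπ : turningAngle v (i + 1) < π := by
      refine lt_of_le_of_ne (angle_le_pi _ _) fun h1 => ?_
      -- At angle `π` the default values `tan (π / 2) = 0` and division by zero make `rad` equal to
      -- `0`, against the lower bound.
      rw [h1, tan_pi_div_two, mul_zero, div_zero] at h
      exact lt_irrefl _ h.2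
    have htan : 0 < tan (turningAngle v (i + 1) / 2) :=
      tan_pos_of_pos_of_lt_pi_div_two (by linarith) (by linarith)
    have h2 := h.1
    rw [lt_div_iff₀ (by positivity), lt_min_iff] at h2
    exact ⟨hπ, by linarith [h2.1], by linarith [h2.2]⟩

/-- The thick polygon underlying a polygonal knot. -/
def IsPolygonalKnot.thickPolygon (hv : IsPolygonalKnot v) {R : ℝ} (hR : 0 < R)
    (h : ENNReal.ofReal R < minRad v) : ThickPolygon E3 where
  V j := v j
  u j := direction v j
  L j := edgeLength v j
  R := R
  period := n
  R_pos := hR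
  period_pos := by have := hv.three_le; omega
  norm_u j := hv.norm_direction j
  V_succ j := by rw [hv.edgeLength_smul_direction]; push_cast; abel
  neg_one_lt_inner j := by
    have h1 := (hv.corner_bounds j (h.trans_le (iInf_le _ _))).1
    rw [← hv.angle_direction] at h1
    have h2 : inner ℝ (direction v j) (direction v (j + 1)) =
        cos (angle (direction v j) (direction v (j + 1))) := by
      rw [cos_angle, hv.norm_direction, hv.norm_direction]; simp
    push_cast
    rw [h2, ← cos_pi]
    exact cos_lt_cos_of_nonneg_of_le_pi (angle_nonneg _ _) le_rfl h1
  lt_length j := by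
    have h1 := (hv.corner_bounds j (h.trans_le (iInf_le _ _))).2.1
    rw [← hv.angle_direction] at h1
    push_cast
    exact h1
  lt_length_succ j := by
    have h1 := (hv.corner_bounds j (h.trans_le (iInf_le _ _))).2.2
    rw [← hv.angle_direction] at h1
    push_cast
    exact h1
  V_periodic j := by simp
  u_periodic j := by simp
  L_periodic j := by simp

theorem IsPolygonalKnot.thickPolygon_K (hv : IsPolygonalKnot v) {R : ℝ} (hR : 0 < R)
    (h : ENNReal.ofReal R < minRad v) : (hv.thickPolygon hR h).K = param v := by
  funext t
  change v ⌊t⌋ + (edgeLength v ⌊t⌋ * Int.fract t) • direction v ⌊t⌋ = _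
  rw [mul_comm, mul_smul, hv.edgeLength_smul_direction, param, AffineMap.lineMap_apply,
    vsub_eq_sub, vadd_eq_add, add_comm]

theorem range_param (v : ZMod n → E3) (hn : n ≠ 0) : Set.range (param v) = carrier v := by
  have : NeZero n := ⟨hn⟩
  ext X
  simp only [carrier, edge, segment_eq_image_lineMap, Set.mem_iUnion]
  constructor
  · rintro ⟨t, rfl⟩
    exact ⟨_, _, ⟨Int.fract_nonneg t, (Int.fract_lt_one t).le⟩, rfl⟩
  · rintro ⟨i, x, ⟨h0, h1⟩, rfl⟩
    obtain ⟨j, rfl⟩ := ZMod.intCast_surjective i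
    refine ⟨j + x, ?_⟩
    have := piecewise_eq
      (H := fun (j : ℤ) x => (AffineMap.lineMap (v j) (v ((j : ZMod n) + 1)) x : E3))
      (fun j => by simp) j h0 h1
    exact this

/-- The parametrization of a polygonal knot is injective on each period. -/
theorem IsPolygonalKnot.param_ne (hv : IsPolygonalKnot v) {s t : ℝ} (hst : s < t)
    (hts : t < s + n) : param v s ≠ param v t := by
  obtain ⟨i, x, hx0, hx1, rfl⟩ := exists_int_add s
  obtain ⟨j, y, hy0, hy1, rfl⟩ := exists_int_add t
  have hpar : ∀ (i : ℤ) (x : ℝ), 0 ≤ x → x < 1 → param v (i + x) =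
      AffineMap.lineMap (v i) (v ((i : ZMod n) + 1)) x := fun i x h0 h1 => by
    have : ⌊(i : ℝ) + x⌋ = i := Int.floor_eq_iff.2 ⟨by linarith, by linarith⟩
    rw [param, Int.fract, this, add_sub_cancel_left]
  rw [hpar i x hx0 hx1, hpar j y hy0 hy1]
  intro h
  have hmem : ∀ (i : ZMod n) (x : ℝ), 0 ≤ x → x < 1 →
      (AffineMap.lineMap (v i) (v (i + 1)) x : E3) ∈ edge v i := fun i x h0 h1 => by
    rw [edge, segment_eq_image_lineMap]; exact ⟨x, ⟨h0, h1.le⟩, rfl⟩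
  have hend : ∀ (i : ZMod n) (x : ℝ), x < 1 →
      (AffineMap.lineMap (v i) (v (i + 1)) x : E3) ≠ v (i + 1) := fun i x h1 he => by
    rw [AffineMap.lineMap_eq_right_iff] at he
    rcases he with he | he
    · exact hv.ne_succ i he
    · linarith
  have m1 := hmem i x hx0 hx1
  have m2 := hmem j y hy0 hy1
  by_cases hij : (i : ZMod n) = j
  · rw [hij] at h
    -- On the same edge modulo `n` the fractional parts agree, so `t - s` would be a multiple of `n`
    -- strictly between `0` and `n`.
    have hxy := AffineMap.lineMap_injective ℝ (hv.ne_succ j) h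
    rw [ZMod.intCast_eq_intCast_iff_dvd_sub] at hij
    obtain ⟨k, hk⟩ := hij
    have hk' : (j : ℝ) - i = n * k := by exact_mod_cast hk
    have hn : (0 : ℝ) < n := by
      have := hv.three_le
      exact_mod_cast (by omega : 0 < n)
    have e1 : (0 : ℝ) < k := by
      by_contra! h'
      nlinarith
    have e2 : (k : ℝ) < 1 := by
      by_contra! h'
      nlinarith
    have e1' : (0 : ℤ) < k := by exact_mod_cast e1
    have e2' : k < (1 : ℤ) := by exact_mod_cast e2
    omega
  by_cases hij1 : (j : ZMod n) = i + 1
  · have : (AffineMap.lineMap (v i) (v ((i : ZMod n) + 1)) x : E3) ∈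
        edge v i ∩ edge v ((i : ZMod n) + 1) := ⟨m1, by rw [h, ← hij1]; exact m2⟩
    rw [hv.consecutive] at this
    exact hend _ x hx1 this
  by_cases hij2 : (i : ZMod n) = j + 1
  · have : (AffineMap.lineMap (v j) (v ((j : ZMod n) + 1)) y : E3) ∈
        edge v j ∩ edge v ((j : ZMod n) + 1) := ⟨m2, by rw [← h, ← hij2]; exact m1⟩
    rw [hv.consecutive] at this
    exact hend _ y hy1 this
  · rw [h] at m1
    exact Set.disjoint_left.1 (hv.disjoint i j hij hij1 hij2) m1 m2

theorem mem_tube_iff {r : ℝ} {X : E3} : X ∈ tube v r ↔ ∃ y ∈ carrier v, dist X y ≤ r := by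
  simp only [tube, edgeTube, carrier, Set.mem_iUnion, Metric.mem_closedBall]
  constructor
  · rintro ⟨i, y, hy, h⟩; exact ⟨y, ⟨i, hy⟩, h⟩
  · rintro ⟨y, ⟨i, hy⟩, h⟩; exact ⟨i, y, hy, h⟩

theorem isCompact_carrier (v : ZMod n → E3) (hn : n ≠ 0) : IsCompact (carrier v) := by
  have : NeZero n := ⟨hn⟩
  refine isCompact_iUnion fun i => ?_
  rw [edge, segment_eq_image_lineMap]
  exact isCompact_Icc.image AffineMap.lineMap_continuous

end PolygonalKnot
end

/-! ### The main theorem. -/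

open PolygonalKnot in
theorem mainTheorem1 (n : ℕ) (v : ZMod n → PolygonalKnot.E3)
    (hv : PolygonalKnot.IsPolygonalKnot v) (r : ℝ) (hr : 0 < r)
    (hrR : ENNReal.ofReal r < PolygonalKnot.thicknessRadius v) :
    PolygonalKnot.IsEmbeddedSolidTorus (PolygonalKnot.tube v r) (PolygonalKnot.carrier v) := by
  have hn : n ≠ 0 := by have := hv.three_le; omega
  -- The arcs need a finite radius strictly between `r` and the thickness radius, which may be
  -- infinite a priori.
  obtain ⟨R, hR0, hrR1, hR⟩ := ENNReal.lt_iff_exists_real_btwn.1 hrR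
  have hrR' : r < R := (ENNReal.ofReal_lt_ofReal_iff'.1 hrR1).1
  have hRpos : 0 < R := hr.trans hrR'
  have hmin : ENNReal.ofReal R < minRad v := hR.trans_le (min_le_left _ _)
  set P := hv.thickPolygon hRpos hmin with hP
  have hK : P.K = param v := hv.thickPolygon_K hRpos hmin
  have hturn : ∀ (q : E3) (s : ℝ), IsLocalMin (fun x => dist q (param v x)) s →
      IsTurningPoint v q (param v s) := by
    intro q s h
    rw [← hK] at h
    obtain ⟨ε, hε, h1⟩ := P.strictMonoOn_dist_of_isLocalMin h
    obtain ⟨δ, hδ, h2⟩ := P.strictAntiOn_dist_of_isLocalMin h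
    rw [hK] at h1 h2
    refine ⟨s, min ε δ, lt_min hε hδ, rfl, Or.inr ⟨h2.mono ?_, h1.mono ?_⟩⟩
    · exact Set.Icc_subset_Icc_left (by linarith [min_le_right ε δ])
    · exact Set.Icc_subset_Icc_right (by linarith [min_le_left ε δ])
  have hdc : ∀ s t : ℝ, s < t → t < s + P.period → IsLocalMin (fun x => dist (P.K t) (P.K x)) s →
      IsLocalMin (fun x => dist (P.K s) (P.K x)) t → 2 * r < ‖P.K t - P.K s‖ := by
    rw [hK]
    intro s t hst hts h1 h2
    have hmem : (param v s, param v t) ∈ doublyCritical v := by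
      refine ⟨?_, ?_, hv.param_ne hst hts, hturn _ _ h1, hturn _ _ h2⟩ <;>
      · rw [← range_param v hn]; exact Set.mem_range_self _
    have h3 : dcsd v ≤ edist (param v s) (param v t) := iInf₂_le _ hmem
    have h4 : ENNReal.ofReal r < edist (param v s) (param v t) / 2 :=
      (hrR.trans_le (min_le_right _ _)).trans_le (ENNReal.div_le_div_right h3 2)
    have e : ∀ d : ℝ, ENNReal.ofReal d / 2 = ENNReal.ofReal (d / 2) := fun d => by
      rw [ENNReal.ofReal_div_of_pos two_pos, ENNReal.ofReal_ofNat]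
    rw [edist_dist, e, ENNReal.ofReal_lt_ofReal_iff'] at h4
    rw [← dist_eq_norm, dist_comm]
    linarith [h4.1]
  -- Frames and angles are chosen for indices modulo `n`, so periodicity is automatic; any holonomy
  -- is absorbed by the angles.
  choose F hF using fun i : ZMod n => exists_isFrame (hv.norm_direction i)
  have hrot : ∀ i : ZMod n, ∃ θ : ℝ, ∀ z, transfer (direction v i) (direction v (i + 1))
      (F i (Complex.exp (θ * Complex.I) * z)) = F (i + 1) z := fun i => by
    obtain ⟨j, rfl⟩ := ZMod.intCast_surjective i
    have h := P.neg_one_lt_inner j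
    change -1 < inner ℝ (direction v j) (direction v (j + 1 : ℤ)) at h
    push_cast at h
    exact (hF j).exists_rotation (hv.norm_direction _) (hv.norm_direction _) h (hF _)
  choose θ hθ using hrot
  obtain ⟨h, hemb, hrange, hcore⟩ := ThickPolygon.exists_embedding (P := P)
    (F := fun j => F j) (θ := fun j => θ j) hr hrR' hdc (fun j => hF j)
    (fun j => by
      change F ((j + n : ℤ) : ZMod n) = F j
      simp)
    (fun j z => by
      change transfer (direction v j) (direction v (j + 1 : ℤ)) _ = F (j + 1 : ℤ) z
      push_cast
      exact hθ j z)
    (fun j => by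
      change θ ((j + n : ℤ) : ZMod n) = θ j
      simp)
  refine ⟨h, hemb, ?_, ?_⟩
  · rw [hrange]
    ext X
    rw [mem_tube_iff, ← range_param v hn, ← hK]
    constructor
    · rintro ⟨t, ht⟩
      obtain ⟨t', h1, -⟩ := ht.exists_foot hrR'
      exact ⟨_, Set.mem_range_self t', by rwa [dist_eq_norm]⟩
    · rintro ⟨y, hy, hXy⟩
      have hcpt := isCompact_carrier v hn
      rw [← range_param v hn, ← hK] at hcpt
      obtain ⟨_, ⟨t₀, rfl⟩, hnear⟩ := hcpt.exists_isMinOn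
        (f := fun y => dist X y) ⟨y, hy⟩ (by fun_prop)
      have hnear' : ∀ z ∈ Set.range P.K, ‖X - P.K t₀‖ ≤ dist X z := fun z hz => by
        rw [← dist_eq_norm]; exact hnear hz
      exact ThickPolygon.exists_inLeaf_of_nearest hrR' ((hnear' y hy).trans hXy) fun t => by
        rw [← dist_eq_norm X (P.K t)]; exact hnear' _ (Set.mem_range_self t)
  · rw [hcore, hK, range_param v hn]
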